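/- Notation. An $n$-bit gate is a unitary operator on $(\mathbb C^2)^{\otimes n}$. For a 1-bit gate $A$, $A(\ell)$ is $A$ acting on slot $\ell$; for a 2-bit gate $B$ and $\ell\ne m$, $B(\ell,m)$ is $B$ acting on the slots $\ell,m$. A collection of 1-bit gates $A_i$ and 2-bit gates $B_j$ is *universal* if, for every $n\ge2$, every $n$-bit gate is a finite composition of gates $A_i(\ell)$ and $B_j(\ell,m)$, $\ell\neq m$; it is *universal up to global phases* if, for every $n\ge 2$, every $n$-bit gate of determinant $1$ is such a composition and every $n$-bit gate is one after multiplication by some $c\in\mathbb C$ with $|c|=1$. Put $$U_{\theta,\phi}=\begin{pmatrix}\cos\theta&-ie^{-i\phi}\sin\theta\\-ie^{i\phi}\sin\theta&\cos\theta\end{pmatrix},\qquad Q_\pi=\mathrm{diag}(1,1,1,-1),$$ and let $\Lambda_1(\sigma_x)$ be the CNOT gate (the first qubit being the control). The ion trap. Let $\hbar,\eta,\Omega>0$. The Hilbert space of $N\ge 2$ ions has the orthonormal basis $|j_1\rangle\cdots|j_N\rangle|k\rangle_{\rm CM}$ with $j_i\in\{0,1,\alpha\}$ ($0,1$ are the qubit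 levels, $\alpha$ is an auxiliary level) and $k=0,1,2,\dots$ (number of phonons of the center-of-mass mode). Let $a,a^\dagger$ be the phonon annihilation and creation operators. A laser of phase $\phi\in\mathbb R$ on ion $j$ gives one of the Hamiltonians $$H^{\rm res}_j(\phi)=-\tfrac{\hbar\Omega}{2}\bigl[e^{-i\phi}|1\rangle_j\langle0|_j+e^{i\phi}|0\rangle_j\langle1|_j\bigr],$$ $$H_j(\phi)=\tfrac{\hbar\eta\Omega}{2\sqrt N}\bigl[e^{-i\phi}|1\rangle_j\langle0|_j\,a+e^{i\phi}|0\rangle_j\langle1|_j\,a^\dagger\bigr],\qquad H^{\rm aux}_j(\phi)=\tfrac{\hbar\eta\Omega}{2\sqrt N}\bigl[e^{-i\phi}|\alpha\rangle_j\langle0|_j\,a+e^{i\phi}|0\rangle_j\langle\alpha|_j\,a^\dagger\bigr].$$ A pulse is $e^{-iHt/\hbar}$ with $t\ge0$ and $H$ one of these. An operator $W$ on the Hilbert space implements an operator $U$ on $N$ qubits if $W(|x\rangle|0\rangle_{\rm CM})=(U|x\rangle)|0\rangle_{\rm CM}$ for all $x\in\{0,1\}^N$; and $U$ is realizable if a finite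 composition of pulses implements it. Theorem 4.4. The ion-trap quantum computer is universal. More precisely: 1. For all $N\ge2$, $1\le\ell\le N$ and $\theta,\phi\in[0,2\pi]$, the pulse under $H^{\rm res}_\ell(\pi-\phi)$ of duration $2\theta/\Omega$ implements $U_{\theta,\phi}(\ell)$. 2. For all $N\ge2$ and $\ell\ne m$, with $T=\frac{\pi}{\eta\Omega}\sqrt N$, the operator $e^{-iH_\ell(0)T/\hbar}\,e^{-iH^{\rm aux}_m(0)2T/\hbar}\,e^{-iH_\ell(0)T/\hbar}$ implements $Q_\pi(\ell,m)$. 3. For all $n\ge2$ and $\ell\ne m$, $\Lambda_1(\sigma_x)(\ell,m)=U_{\pi/4,\pi/2}(m)\,Q_\pi(\ell,m)\,U_{\pi/4,-\pi/2}(m)$. 4. The collection of all $U_{\theta,\phi}$, $0\le\theta,\phi\le2\pi$, together with $Q_\pi$ is universal up to global phases, and so is the collection of all $U_{\theta,\phi}$ together with $\Lambda_1(\sigma_x)$. 5. The collection of all 1-bit gates $A$ and 2-bit gates $B$ such that $A(\ell)$, respectively $B(\ell,m)$, is realizable for all $N\ge2$ and all $\ell$, respectively all $\ell\neq m$, is universal;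 and for every $n\ge2$ every $n$-bit gate is realizable on $n$ ions. -/

import Mathlib

namespace IonTrap

open Complex

noncomputable section

/-! ### Gates on qubits -/

/-- The basis of `(ℂ²)^{⊗ n}`: bit strings of length `n`. -/
abbrev Bits (n : ℕ) := Fin n → Fin 2

/-- Operators on `n` qubits, as matrices in the computational basis. -/
abbrev QOp (n : ℕ) := Matrix (Bits n) (Bits n) ℂ

/-- Operators on one qubit. -/
abbrev OneBit := Matrix (Fin 2) (Fin 2) ℂ

/-- Operators on two qubits; the basis vector `|x₁ x₂⟩` is indexed by the pair `(x₁, x₂)`. -/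
abbrev TwoBit := Matrix (Fin 2 × Fin 2) (Fin 2 × Fin 2) ℂ

/-- `A(ℓ)`: the one-qubit operator `A` acting on slot `ℓ` of `n` qubits. -/
def onQubit {n : ℕ} (l : Fin n) (A : OneBit) : QOp n :=
  Matrix.of fun y x => if ∀ i, i ≠ l → y i = x i then A (y l) (x l) else 0

/-- `B(ℓ, m)`: the two-qubit operator `B` acting on the slots `ℓ` and `m` (used for `ℓ ≠ m`). -/
def onPair {n : ℕ} (l m : Fin n) (B : TwoBit) : QOp n :=
  Matrix.of fun y x =>
    if ∀ i, i ≠ l → i ≠ m → y i = x i then B (y l, y m) (x l, x m) else 0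

/-- The rotation gate `U_{θ,φ}`. -/
def rotationGate (θ φ : ℝ) : OneBit :=
  !![(Real.cos θ : ℂ), -I * exp (-(I * φ)) * (Real.sin θ : ℂ);
     -I * exp (I * φ) * (Real.sin θ : ℂ), (Real.cos θ : ℂ)]

/-- The quantum phase gate `Q_η = diag (1, 1, 1, e^{iη})`. -/
def phaseGate (η : ℝ) : TwoBit :=
  Matrix.diagonal fun p => if p = (1, 1) then exp (I * η) else 1

/-- The NOT gate `σ_x`. -/
def sigmaX : OneBit := !![0, 1; 1, 0]

/-- The controlled gate `Λ₁(U)`; the first qubit is the control. -/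
def controlled (U : OneBit) : TwoBit :=
  Matrix.of fun y x =>
    if y.1 = x.1 then
      (if x.1 = 1 then U y.2 x.2 else if y.2 = x.2 then 1 else 0)
    else 0

/-- The CNOT gate `Λ₁(σ_x)`. -/
def cnot : TwoBit := controlled sigmaX

/-- All `U_{θ,φ}` with `0 ≤ θ, φ ≤ 2π`. -/
def rotations : Set OneBit :=
  {A | ∃ θ ∈ Set.Icc (0 : ℝ) (2 * Real.pi), ∃ φ ∈ Set.Icc (0 : ℝ) (2 * Real.pi),
    A = rotationGate θ φ}

/-- The operators on `n` qubits that are finite compositions of the operators `A(ℓ)` with `A ∈ S₁`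
and `B(ℓ, m)` with `B ∈ S₂`, `ℓ ≠ m`. -/
def compositions (S₁ : Set OneBit) (S₂ : Set TwoBit) (n : ℕ) : Submonoid (QOp n) :=
  Submonoid.closure
    ({M | ∃ A ∈ S₁, ∃ l : Fin n, M = onQubit l A} ∪
     {M | ∃ B ∈ S₂, ∃ l m : Fin n, l ≠ m ∧ M = onPair l m B})

/-- (Exact) universality: for each `n ≥ 2` every `n`-bit gate, i.e. every unitary operator on `n`
qubits, is a composition of gates of the collection. -/
def IsUniversal (S₁ : Set OneBit) (S₂ : Set TwoBit) : Prop :=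
  ∀ n : ℕ, 2 ≤ n → ∀ U ∈ Matrix.unitaryGroup (Bits n) ℂ, U ∈ compositions S₁ S₂ n

/-- Universality up to global phases: for each `n ≥ 2` every `n`-bit gate of determinant one is a
composition of gates of the collection, and every `n`-bit gate is so up to a scalar of modulus one. -/
def IsUniversalUpToPhase (S₁ : Set OneBit) (S₂ : Set TwoBit) : Prop :=
  ∀ n : ℕ, 2 ≤ n →
    (∀ U ∈ Matrix.specialUnitaryGroup (Bits n) ℂ, U ∈ compositions S₁ S₂ n) ∧
    (∀ U ∈ Matrix.unitaryGroup (Bits n) ℂ, ∃ c : ℂ, ‖c‖ = 1 ∧ c • U ∈ compositions S₁ S₂ n)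

/-! ### Ions in a trap -/

/-- The internal levels of an ion: `some 0` and `some 1` are the qubit levels `|0⟩` and `|1⟩`,
`none` is the auxiliary level `|α⟩`. -/
abbrev IonLevel := Option (Fin 2)

/-- The label of the basis vector `|j₁⟩ ⋯ |j_N⟩ |k⟩_CM`: the levels of the `N` ions and the number
`k` of phonons of the center-of-mass mode. -/
abbrev Config (N : ℕ) := (Fin N → IonLevel) × ℕ

/-- The Hilbert space of `N` ions and the center-of-mass mode. -/
abbrev TrapSpace (N : ℕ) := lp (fun _ : Config N => ℂ) 2

/-- The basis vector `|j₁⟩ ⋯ |j_N⟩ |k⟩_CM`. -/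
def ket {N : ℕ} (c : Config N) : TrapSpace N := lp.single 2 c 1

/-- Finite linear combinations of the basis vectors, the common domain of the operators below. -/
abbrev FiniteState (N : ℕ) := Config N →₀ ℂ

/-- The inclusion of the finite linear combinations in the Hilbert space. -/
def toTrapSpace {N : ℕ} : FiniteState N →ₗ[ℂ] TrapSpace N := Finsupp.linearCombination ℂ ket

/-- The phonon annihilation operator: `a |n⟩ = √n |n - 1⟩`, and `a |0⟩ = 0`. -/
def annihilation {N : ℕ} : FiniteState N →ₗ[ℂ] FiniteState N :=
  Finsupp.linearCombination ℂ fun c =>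
    Finsupp.single (c.1, c.2 - 1) ((Real.sqrt (c.2 : ℝ) : ℝ) : ℂ)

/-- The phonon creation operator: `a† |n⟩ = √(n + 1) |n + 1⟩`. -/
def creation {N : ℕ} : FiniteState N →ₗ[ℂ] FiniteState N :=
  Finsupp.linearCombination ℂ fun c =>
    Finsupp.single (c.1, c.2 + 1) ((Real.sqrt ((c.2 : ℝ) + 1) : ℝ) : ℂ)

/-- The operator `|p⟩_j ⟨q|_j` on the internal levels of the ion `j`. -/
def ketBra {N : ℕ} (j : Fin N) (p q : IonLevel) : FiniteState N →ₗ[ℂ] FiniteState N :=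
  Finsupp.linearCombination ℂ fun c =>
    if c.1 j = q then Finsupp.single (Function.update c.1 j p, c.2) (1 : ℂ) else 0

/-- The effective Hamiltonian of a laser beam of phase `φ` on the ion `j`, resonant with the qubit
transition, `Ω` being the Rabi frequency:
`-(ħΩ/2) (e^{-iφ} |1⟩_j ⟨0|_j + e^{iφ} |0⟩_j ⟨1|_j)`. -/
def carrierHamiltonian {N : ℕ} (hbar Ω : ℝ) (j : Fin N) (φ : ℝ) :
    FiniteState N →ₗ[ℂ] FiniteState N :=
  (-((hbar * Ω / 2 : ℝ) : ℂ)) •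
    (exp (-(I * φ)) • ketBra j (some 1) (some 0) + exp (I * φ) • ketBra j (some 0) (some 1))

/-- The Hamiltonian of a laser beam of phase `φ` on the ion `j`, tuned to the red sideband of the
transition between `|0⟩` and `|u⟩`, `η` being the Lamb-Dicke parameter:
`(ħηΩ / (2√N)) (e^{-iφ} |u⟩_j ⟨0|_j a + e^{iφ} |0⟩_j ⟨u|_j a†)`. -/
def sidebandHamiltonian {N : ℕ} (hbar η Ω : ℝ) (u : IonLevel) (j : Fin N) (φ : ℝ) :
    FiniteState N →ₗ[ℂ] FiniteState N :=
  ((hbar * η * Ω / (2 * Real.sqrt (N : ℝ)) : ℝ) : ℂ) •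
    (exp (-(I * φ)) • (ketBra j u (some 0) ∘ₗ annihilation) +
      exp (I * φ) • (ketBra j (some 0) u ∘ₗ creation))

/-- `H_j`: the sideband Hamiltonian of the qubit transition. -/
def qubitSideband {N : ℕ} (hbar η Ω : ℝ) (j : Fin N) (φ : ℝ) :
    FiniteState N →ₗ[ℂ] FiniteState N :=
  sidebandHamiltonian hbar η Ω (some 1) j φ

/-- `H_j^aux`: the sideband Hamiltonian of the transition to the auxiliary level. -/
def auxSideband {N : ℕ} (hbar η Ω : ℝ) (j : Fin N) (φ : ℝ) :
    FiniteState N →ₗ[ℂ] FiniteState N :=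
  sidebandHamiltonian hbar η Ω none j φ

/-- `V t = e^{-iHt/ħ}`: a strongly continuous one-parameter group of unitary operators of the
Hilbert space whose generator is `-iH/ħ` on the finite linear combinations of basis vectors. -/
structure IsTimeEvolution {N : ℕ} (hbar : ℝ) (H : FiniteState N →ₗ[ℂ] FiniteState N)
    (V : ℝ → (TrapSpace N ≃ₗᵢ[ℂ] TrapSpace N)) : Prop where
  map_add : ∀ s t : ℝ, V (s + t) = V s * V t
  continuous : ∀ ψ : TrapSpace N, Continuous fun t => V t ψ
  schrodinger : ∀ f : FiniteState N,
    HasDerivAt (fun t => V t (toTrapSpace f)) ((-(I / (hbar : ℂ))) • toTrapSpace (H f)) 0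

/-- A laser pulse: the evolution for some time `t ≥ 0` under one of the three Hamiltonians, for
some ion and some phase of the laser. -/
def IsPulse {N : ℕ} (hbar η Ω : ℝ) (W : TrapSpace N ≃ₗᵢ[ℂ] TrapSpace N) : Prop :=
  ∃ (j : Fin N) (φ t : ℝ) (H : FiniteState N →ₗ[ℂ] FiniteState N)
    (V : ℝ → (TrapSpace N ≃ₗᵢ[ℂ] TrapSpace N)),
    0 ≤ t ∧
    (H = carrierHamiltonian hbar Ω j φ ∨ H = qubitSideband hbar η Ω j φ ∨
      H = auxSideband hbar η Ω j φ) ∧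
    IsTimeEvolution hbar H V ∧ W = V t

/-- The register state `|x₁⟩ ⋯ |x_N⟩ |0⟩_CM`. -/
def registerKet {N : ℕ} (x : Bits N) : TrapSpace N := ket (fun i => some (x i), 0)

/-- `W` acts as `U` on the qubits when the center-of-mass mode starts in its ground state, to which
it returns: `W |x⟩ |0⟩_CM = (U |x⟩) |0⟩_CM`. -/
def Implements {N : ℕ} (W : TrapSpace N ≃ₗᵢ[ℂ] TrapSpace N) (U : QOp N) : Prop :=
  ∀ x : Bits N, W (registerKet x) = ∑ y : Bits N, U y x • registerKet y

/-- `U` is implemented exactly by a finite sequence of laser pulses on `N` trapped ions. -/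
def IonRealizable {N : ℕ} (hbar η Ω : ℝ) (U : QOp N) : Prop :=
  ∃ W ∈ Submonoid.closure {W : TrapSpace N ≃ₗᵢ[ℂ] TrapSpace N | IsPulse hbar η Ω W},
    Implements W U

/-- The 1-bit gates that can be implemented on every ion of every trap with at least two ions. -/
def ionOneBitGates (hbar η Ω : ℝ) : Set OneBit :=
  {A | A ∈ Matrix.unitaryGroup (Fin 2) ℂ ∧
    ∀ N : ℕ, 2 ≤ N → ∀ l : Fin N, IonRealizable hbar η Ω (onQubit l A)}

/-- The 2-bit gates that can be implemented on every ordered pair of distinct ions of every trap. -/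
def ionTwoBitGates (hbar η Ω : ℝ) : Set TwoBit :=
  {B | B ∈ Matrix.unitaryGroup (Fin 2 × Fin 2) ℂ ∧
    ∀ N : ℕ, 2 ≤ N → ∀ l m : Fin N, l ≠ m → IonRealizable hbar η Ω (onPair l m B)}

end

end IonTrap

open IonTrap

/-! The proof has an algebraic half and a dynamical half.

Algebra: column elimination shows that the special unitary group is generated by determinant-one
operators acting on two basis vectors (`specialUnitaryGroup_le_of_twoLevel_mem`). Having all such
operators is a transitive relation on basis vectors (`twoLevel_mem_trans`), so the edges of the
hypercube of bit strings suffice, and along an edge such an operator is a one-qubit gate controlled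
by all other qubits. Controls are created by commutators. Conjugation by `sigmaZ` reverses a
rotation, so `R(θ/2) σ_z R(-θ/2) σ_z = R(θ)`, whereas the product collapses to the identity when the
`σ_z` are absent. The phase gate, a controlled `σ_z`, gives the first control, and iteration gives
the others (`multicontrolled_mem`). Three rotations make up any element of SU(2), and CNOT is
conjugate to the phase gate by rotations.

Dynamics: each Hamiltonian pairs basis vectors by an involution, hence splits into blocks of size at
most two, and its evolution is written down with cosines and sines although it may be unbounded
(`exists_isTimeEvolution`). Resonant pulses are then rotations. For the phase gate, ion `l` hands
its excitation to the phonon mode and takes it back, which costs a sign; in between, a full cycle of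
ion `m` through the auxiliary level gives a second sign exactly when `m` is in level 0.

Exact universality also needs the scalars. An excitation sent through the auxiliary level and back
with two different laser phases acquires an arbitrary phase (`phaseShift_realizable`), from which
every global phase is built. -/

namespace IonTrap

open Complex
open scoped Matrix InnerProductSpace

set_option linter.unusedSimpArgs false
set_option linter.unusedSectionVars false

/-! ### Two-level operators -/

section TwoLevel

variable {ι : Type*} [Fintype ι] [DecidableEq ι]

/-- The isometry `ℂ² → ℂ^ι` sending the basis vector `a` to the basis vector `e a`. -/
def levelEmbedding (e : Fin 2 → ι) : Matrix ι (Fin 2) ℂ :=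
  (1 : Matrix ι ι ℂ).submatrix id e

/-- The operator acting as `A` on the span of the basis vectors `e 0`, `e 1`, and trivially on the
other basis vectors. -/
def twoLevel (e : Fin 2 → ι) (A : OneBit) : Matrix ι ι ℂ :=
  1 + levelEmbedding e * (A - 1) * (levelEmbedding e).transpose

theorem levelEmbedding_transpose_mul_self {e : Fin 2 → ι} (he : Function.Injective e) :
    (levelEmbedding e).transpose * levelEmbedding e = 1 := by
  ext a b
  simp [levelEmbedding, Matrix.mul_apply, Matrix.one_apply, he.eq_iff, eq_comm]

theorem twoLevel_one (e : Fin 2 → ι) : twoLevel e 1 = 1 := by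
  simp [twoLevel]

theorem twoLevel_mul {e : Fin 2 → ι} (he : Function.Injective e) (A B : OneBit) :
    twoLevel e A * twoLevel e B = twoLevel e (A * B) := by
  have h := levelEmbedding_transpose_mul_self he
  simp only [twoLevel]
  generalize levelEmbedding e = J at h
  have h' : J * (A - 1) * J.transpose * (J * (B - 1) * J.transpose) =
      J * ((A - 1) * (B - 1)) * J.transpose := by
    calc _ = J * (A - 1) * (J.transpose * J) * (B - 1) * J.transpose := by
          simp only [Matrix.mul_assoc]
      _ = _ := by rw [h]; simp only [Matrix.mul_assoc, Matrix.one_mul, Matrix.mul_one]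
  rw [add_mul, mul_add, mul_add, h', one_mul, mul_one, one_mul, add_assoc, ← Matrix.add_mul,
    ← Matrix.mul_add, ← Matrix.add_mul, ← Matrix.mul_add]
  congr 4
  noncomm_ring

theorem star_twoLevel (e : Fin 2 → ι) (A : OneBit) :
    star (twoLevel e A) = twoLevel e (star A) := by
  have h : (levelEmbedding e).conjTranspose = (levelEmbedding e).transpose := by
    ext a b
    simp [levelEmbedding, Matrix.one_apply, apply_ite]
  have h' : (levelEmbedding e).transpose.conjTranspose = levelEmbedding e := by
    rw [← h, Matrix.conjTranspose_conjTranspose]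
  simp only [twoLevel, Matrix.star_eq_conjTranspose, Matrix.conjTranspose_add,
    Matrix.conjTranspose_mul, h, h', Matrix.conjTranspose_sub, Matrix.conjTranspose_one,
    Matrix.mul_assoc]

theorem det_twoLevel {e : Fin 2 → ι} (he : Function.Injective e) (A : OneBit) :
    (twoLevel e A).det = A.det := by
  -- The identity `det (1 + XY) = det (1 + YX)` reduces the determinant to size two.
  rw [twoLevel, Matrix.mul_assoc, Matrix.det_one_add_mul_comm, Matrix.mul_assoc,
    levelEmbedding_transpose_mul_self he, Matrix.mul_one, add_sub_cancel]

theorem twoLevel_mem_specialUnitaryGroup {e : Fin 2 → ι} (he : Function.Injective e) {A : OneBit}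
    (hA : A ∈ Matrix.specialUnitaryGroup (Fin 2) ℂ) :
    twoLevel e A ∈ Matrix.specialUnitaryGroup ι ℂ := by
  rw [Matrix.mem_specialUnitaryGroup_iff] at hA ⊢
  refine ⟨?_, by rw [det_twoLevel he, hA.2]⟩
  rw [Matrix.mem_unitaryGroup_iff, star_twoLevel, twoLevel_mul he,
    Matrix.mem_unitaryGroup_iff.1 hA.1, twoLevel_one]

theorem twoLevel_mulVec (e : Fin 2 → ι) (A : OneBit) (v : ι → ℂ) :
    twoLevel e A *ᵥ v = v + levelEmbedding e *ᵥ ((A - 1) *ᵥ (v ∘ e)) := by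
  have h : (levelEmbedding e).transpose *ᵥ v = v ∘ e := by
    ext a
    simp [levelEmbedding, Matrix.mulVec, dotProduct, Matrix.one_apply]
  rw [twoLevel, Matrix.add_mulVec, Matrix.one_mulVec, ← Matrix.mulVec_mulVec, h,
    ← Matrix.mulVec_mulVec]

theorem twoLevel_mulVec_apply {e : Fin 2 → ι} (he : Function.Injective e) (A : OneBit) (v : ι → ℂ)
    (a : Fin 2) : (twoLevel e A *ᵥ v) (e a) = (A *ᵥ (v ∘ e)) a := by
  rw [twoLevel_mulVec, Pi.add_apply, Matrix.sub_mulVec, Matrix.one_mulVec]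
  fin_cases a <;> simp [levelEmbedding, Matrix.mulVec, dotProduct, Matrix.one_apply, he.eq_iff]

theorem twoLevel_mulVec_apply_of_ne (e : Fin 2 → ι) (A : OneBit) (v : ι → ℂ) {i : ι}
    (hi : ∀ a, i ≠ e a) : (twoLevel e A *ᵥ v) i = v i := by
  rw [twoLevel_mulVec, Pi.add_apply]
  simp [levelEmbedding, Matrix.mulVec, dotProduct, Matrix.one_apply, hi]

theorem twoLevel_mulVec_eq_self (e : Fin 2 → ι) (A : OneBit) (v : ι → ℂ) (hv : v ∘ e = 0) :
    twoLevel e A *ᵥ v = v := by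
  rw [twoLevel_mulVec, hv]; simp

theorem injective_pair {x y : ι} (h : x ≠ y) : Function.Injective ![x, y] := by
  intro a b
  fin_cases a <;> fin_cases b <;> simp [h, h.symm]

/-- An orthogonal `V` sending the basis vectors `e 0`, `e 1` to `f 0`, `f 1` conjugates the two-level
operators on `e` into those on `f`. -/
theorem twoLevel_conj {e f : Fin 2 → ι} {V : Matrix ι ι ℂ}
    (hV : V * V.transpose = 1) (h : V * levelEmbedding e = levelEmbedding f) (A : OneBit) :
    V * twoLevel e A * V.transpose = twoLevel f A := by
  rw [twoLevel, twoLevel, ← h, mul_add, add_mul, mul_one, hV, Matrix.transpose_mul]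
  simp only [Matrix.mul_assoc]

theorem twoLevel_transpose (e : Fin 2 → ι) (A : OneBit) :
    (twoLevel e A).transpose = twoLevel e A.transpose := by
  simp [twoLevel, Matrix.transpose_mul, Matrix.mul_assoc]

theorem twoLevel_swap (x y : ι) (A : OneBit) :
    twoLevel ![y, x] A = twoLevel ![x, y] (sigmaX * A * sigmaX) := by
  have h : levelEmbedding ![y, x] = levelEmbedding ![x, y] * sigmaX := by
    ext i a
    fin_cases a <;> simp [levelEmbedding, sigmaX, Matrix.mul_apply, Fin.sum_univ_two] <;> rfl
  have h1 : sigmaX * sigmaX = 1 := by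
    ext i j; fin_cases i <;> fin_cases j <;> simp [sigmaX]
  have h2 : sigmaX.transpose = sigmaX := by
    ext i j; fin_cases i <;> fin_cases j <;> simp [sigmaX]
  rw [twoLevel, twoLevel, h, Matrix.transpose_mul, h2]
  congr 1
  have : sigmaX * A * sigmaX - 1 = sigmaX * (A - 1) * sigmaX := by
    rw [mul_sub, sub_mul, mul_one, h1]
  rw [this]
  simp only [Matrix.mul_assoc]

theorem sigmaX_conj_mem {A : OneBit} (hA : A ∈ Matrix.specialUnitaryGroup (Fin 2) ℂ) :
    sigmaX * A * sigmaX ∈ Matrix.specialUnitaryGroup (Fin 2) ℂ := by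
  have h1 : sigmaX * sigmaX = 1 := by
    ext i j; fin_cases i <;> fin_cases j <;> simp [sigmaX]
  have h2 : star sigmaX = sigmaX := by
    ext i j; fin_cases i <;> fin_cases j <;> simp [sigmaX, Matrix.star_eq_conjTranspose]
  rw [Matrix.mem_specialUnitaryGroup_iff] at hA ⊢
  constructor
  · have hX : sigmaX ∈ Matrix.unitaryGroup (Fin 2) ℂ := by
      rw [Matrix.mem_unitaryGroup_iff, h2, h1]
    exact mul_mem (mul_mem hX hA.1) hX
  · rw [Matrix.det_mul, Matrix.det_mul, hA.2, mul_one, ← Matrix.det_mul, h1, Matrix.det_one]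

/-- For basis vectors, the relation that all special unitary two-level operators on `x`, `y` belong
to `G` is transitive. -/
theorem twoLevel_mem_trans {G : Submonoid (Matrix ι ι ℂ)} {x y z : ι} (hxy : x ≠ y) (hyz : y ≠ z)
    (hxz : x ≠ z)
    (h₁ : ∀ A ∈ Matrix.specialUnitaryGroup (Fin 2) ℂ, twoLevel ![x, y] A ∈ G)
    (h₂ : ∀ A ∈ Matrix.specialUnitaryGroup (Fin 2) ℂ, twoLevel ![y, z] A ∈ G) :
    ∀ A ∈ Matrix.specialUnitaryGroup (Fin 2) ℂ, twoLevel ![x, z] A ∈ G := by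
  intro A hA
  -- A quarter turn in the plane of `x` and `y`: it sends the basis vector `y` to `x` and fixes `z`,
  -- so conjugation by it moves the pair `y, z` to `x, z`. The plain swap has determinant -1.
  let R : OneBit := !![0, 1; -1, 0]
  have hR : R * R.transpose = 1 := by
    ext i j; fin_cases i <;> fin_cases j <;> simp [R, Matrix.mul_apply]
  have hRs : star R = R.transpose := by
    ext i j; fin_cases i <;> fin_cases j <;> simp [R, Matrix.star_eq_conjTranspose]
  have hRSU : R ∈ Matrix.specialUnitaryGroup (Fin 2) ℂ := by
    rw [Matrix.mem_specialUnitaryGroup_iff, Matrix.mem_unitaryGroup_iff, hRs]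
    exact ⟨hR, by simp [R, Matrix.det_fin_two]⟩
  have hRT : R.transpose ∈ Matrix.specialUnitaryGroup (Fin 2) ℂ := by
    rw [← hRs]; exact (star (⟨R, hRSU⟩ : Matrix.specialUnitaryGroup (Fin 2) ℂ)).2
  have hV : twoLevel ![x, y] R * (twoLevel ![x, y] R).transpose = 1 := by
    rw [twoLevel_transpose, twoLevel_mul (injective_pair hxy), hR, twoLevel_one]
  have hcol : twoLevel ![x, y] R * levelEmbedding ![y, z] = levelEmbedding ![x, z] := by
    ext i a
    change (twoLevel ![x, y] R *ᵥ (fun j => levelEmbedding ![y, z] j a)) i = _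
    by_cases hi : ∀ b, i ≠ ![x, y] b
    · rw [twoLevel_mulVec_apply_of_ne _ _ _ hi]
      have hx := hi 0
      have hy := hi 1
      simp only [Matrix.cons_val_zero, Matrix.cons_val_one] at hx hy
      fin_cases a <;> simp [levelEmbedding, Matrix.one_apply, hx, hy]
    · push Not at hi
      obtain ⟨b, rfl⟩ := hi
      rw [twoLevel_mulVec_apply (injective_pair hxy)]
      fin_cases a <;> fin_cases b <;>
        simp [levelEmbedding, Matrix.one_apply, R, Matrix.mulVec, dotProduct, Fin.sum_univ_two,
          hxy, hxy.symm, hyz, hxz]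
  rw [← twoLevel_conj hV hcol A, twoLevel_transpose]
  exact mul_mem (mul_mem (h₁ R hRSU) (h₂ A hA)) (h₁ _ hRT)

theorem twoLevel_mem_symm {G : Submonoid (Matrix ι ι ℂ)} {x y : ι}
    (h : ∀ A ∈ Matrix.specialUnitaryGroup (Fin 2) ℂ, twoLevel ![x, y] A ∈ G) :
    ∀ A ∈ Matrix.specialUnitaryGroup (Fin 2) ℂ, twoLevel ![y, x] A ∈ G := by
  intro A hA
  rw [twoLevel_swap]
  exact h _ (sigmaX_conj_mem hA)

/-! ### Generation of the special unitary group by column elimination. -/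

/-- A vector of `ℂ²` is rotated to a nonnegative multiple of the first basis vector. -/
theorem exists_specialUnitary_mulVec (α β : ℂ) :
    ∃ A ∈ Matrix.specialUnitaryGroup (Fin 2) ℂ, ∃ r : ℝ, 0 ≤ r ∧
      (A *ᵥ ![α, β]) 0 = r ∧ (A *ᵥ ![α, β]) 1 = 0 := by
  by_cases h0 : α = 0 ∧ β = 0
  · refine ⟨1, one_mem _, 0, le_rfl, ?_, ?_⟩ <;> simp [h0.1, h0.2]
  set r : ℝ := Real.sqrt (normSq α + normSq β) with hr
  have hpos : 0 < normSq α + normSq β := by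
    rcases not_and_or.1 h0 with h | h
    · exact add_pos_of_pos_of_nonneg (normSq_pos.2 h) (normSq_nonneg _)
    · exact add_pos_of_nonneg_of_pos (normSq_nonneg _) (normSq_pos.2 h)
  have hr0 : (r : ℂ) ≠ 0 := by
    exact_mod_cast (Real.sqrt_pos.2 hpos).ne'
  have hrr : (r : ℂ) * r = α * (starRingEnd ℂ) α + β * (starRingEnd ℂ) β := by
    rw [mul_conj, mul_conj, ← ofReal_add, ← ofReal_mul, hr, Real.mul_self_sqrt hpos.le]
  -- The first row is the conjugate of the normalized vector; the second is the orthogonal row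
  -- giving determinant one.
  refine ⟨!![(starRingEnd ℂ) α / r, (starRingEnd ℂ) β / r; -β / r, α / r], ?_, r,
    Real.sqrt_nonneg _, ?_, ?_⟩
  · rw [Matrix.mem_specialUnitaryGroup_iff, Matrix.mem_unitaryGroup_iff]
    constructor
    · ext i j
      fin_cases i <;> fin_cases j <;>
        simp [Matrix.mul_apply, Fin.sum_univ_two, Matrix.star_eq_conjTranspose] <;>
        field_simp <;> (rw [pow_two, hrr]; ring)
    · rw [Matrix.det_fin_two_of]
      field_simp
      rw [pow_two, hrr]; ring
  · simp [Matrix.mulVec, dotProduct, Fin.sum_univ_two]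
    field_simp
    rw [pow_two, hrr]; ring
  · simp [Matrix.mulVec, dotProduct, Fin.sum_univ_two]
    field_simp
    ring

/-- One two-level rotation on `a, y` clears each entry `y` of the column and moves its weight to
`a`. As `G` is only a monoid, membership is recorded for `star g`, the factor that will recover `U`
from `g * U`. Columns supported off `s` are left intact. The entry at `a` becomes nonnegative as
soon as one rotation has occurred. -/
theorem exists_mulVec_eq_zero {G : Submonoid (Matrix ι ι ℂ)}
    (hG : ∀ x y : ι, x ≠ y → ∀ A ∈ Matrix.specialUnitaryGroup (Fin 2) ℂ, twoLevel ![x, y] A ∈ G)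
    {s : Finset ι} {a : ι} (ha : a ∈ s) (v : ι → ℂ) (hv : ∀ x ∉ s, v x = 0) (t : Finset ι)
    (ht : t ⊆ s.erase a) :
    ∃ g ∈ Matrix.specialUnitaryGroup ι ℂ, star g ∈ G ∧
      (∀ w : ι → ℂ, (∀ x ∈ s, w x = 0) → g *ᵥ w = w) ∧
      (∀ x ∉ s, (g *ᵥ v) x = 0) ∧ (∀ x ∈ t, (g *ᵥ v) x = 0) ∧
      (t.Nonempty → ∃ r : ℝ, 0 ≤ r ∧ (g *ᵥ v) a = r) := by
  induction t using Finset.induction_on with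
  | empty =>
    refine ⟨1, one_mem _, by rw [star_one]; exact one_mem _, ?_, ?_, ?_, ?_⟩ <;> simp
    exact hv
  | insert y t hy ih =>
    obtain ⟨g, hg, hgG, hgw, hgs, hgt, -⟩ := ih ((Finset.subset_insert _ _).trans ht)
    have hys := Finset.mem_erase.1 (ht (Finset.mem_insert_self y t))
    have hay : a ≠ y := hys.1.symm
    have hat : a ∉ t := fun h =>
      (Finset.mem_erase.1 (ht (Finset.mem_insert_of_mem h))).1 rfl
    have hinj := injective_pair hay
    obtain ⟨A, hA, r, hr, h0, h1⟩ := exists_specialUnitary_mulVec ((g *ᵥ v) a) ((g *ᵥ v) y)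
    have hcomp : (g *ᵥ v) ∘ ![a, y] = ![(g *ᵥ v) a, (g *ᵥ v) y] := by
      ext i; fin_cases i <;> rfl
    have hne : ∀ x, x ≠ a → x ≠ y → ((twoLevel ![a, y] A * g) *ᵥ v) x = (g *ᵥ v) x := by
      intro x hxa hxy
      rw [← Matrix.mulVec_mulVec, twoLevel_mulVec_apply_of_ne]
      intro b; fin_cases b <;> simpa
    have hA' : star A ∈ Matrix.specialUnitaryGroup (Fin 2) ℂ :=
      (star (⟨A, hA⟩ : Matrix.specialUnitaryGroup (Fin 2) ℂ)).2
    have hya : ((twoLevel ![a, y] A * g) *ᵥ v) a = r := by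
      have := twoLevel_mulVec_apply hinj A (g *ᵥ v) 0
      rw [hcomp, h0] at this
      rw [← Matrix.mulVec_mulVec]; exact this
    have hyy : ((twoLevel ![a, y] A * g) *ᵥ v) y = 0 := by
      have := twoLevel_mulVec_apply hinj A (g *ᵥ v) 1
      rw [hcomp, h1] at this
      rw [← Matrix.mulVec_mulVec]; exact this
    refine ⟨twoLevel ![a, y] A * g, mul_mem (twoLevel_mem_specialUnitaryGroup hinj hA) hg, ?_,
      ?_, ?_, ?_, fun _ => ⟨r, hr, hya⟩⟩
    · rw [star_mul, star_twoLevel]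
      exact mul_mem hgG (hG a y hay _ hA')
    · intro w hw
      rw [← Matrix.mulVec_mulVec, hgw w hw, twoLevel_mulVec_eq_self]
      ext b; fin_cases b
      · exact hw a ha
      · exact hw y hys.2
    · intro x hx
      rw [hne x (fun h => hx (h ▸ ha)) (fun h => hx (h ▸ hys.2))]
      exact hgs x hx
    · intro x hx
      rcases Finset.mem_insert.1 hx with rfl | hx
      · exact hyy
      · rw [hne x (fun h => hat (h ▸ hx)) (fun h => hy (h ▸ hx))]
        exact hgt x hx

/-- The inner product of columns `x` and `i` has the single term `U x i`. -/
theorem unitary_row_of_col {U : Matrix ι ι ℂ} (hU : U ∈ Matrix.unitaryGroup ι ℂ) {x : ι}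
    (hx : ∀ i, U i x = (1 : Matrix ι ι ℂ) i x) (i : ι) : U x i = (1 : Matrix ι ι ℂ) x i := by
  have h1 : star U * U = 1 := Matrix.mem_unitaryGroup_iff'.1 hU
  have h := congrFun (congrFun h1 x) i
  rw [Matrix.mul_apply, Finset.sum_eq_single x] at h
  · simpa [Matrix.star_eq_conjTranspose, hx] using h
  · intro j _ hj
    simp [Matrix.star_eq_conjTranspose, hx, Matrix.one_apply, hj]
  · simp

/-- Induction on the set of columns that may differ from those of the identity: elimination turns
column `a` into a nonnegative multiple of the basis vector `a`, and unitarity makes that multiple 1.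
-/
theorem specialUnitary_mem_of_fixed {G : Submonoid (Matrix ι ι ℂ)}
    (hG : ∀ x y : ι, x ≠ y → ∀ A ∈ Matrix.specialUnitaryGroup (Fin 2) ℂ, twoLevel ![x, y] A ∈ G)
    (s : Finset ι) : ∀ U ∈ Matrix.specialUnitaryGroup ι ℂ,
      (∀ x ∉ s, ∀ i, U i x = (1 : Matrix ι ι ℂ) i x) → U ∈ G := by
  induction s using Finset.induction_on with
  | empty =>
    intro U _ h
    have : U = 1 := by ext i j; exact h j (by simp) i
    rw [this]; exact one_mem _
  | insert a s has ih =>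
    intro U hU h
    have hU' := Matrix.mem_specialUnitaryGroup_iff.1 hU
    have hsupp : ∀ x ∉ insert a s, U x a = 0 := by
      intro x hx
      rw [unitary_row_of_col hU'.1 (h x hx) a, Matrix.one_apply_ne]
      exact fun e => hx (e ▸ Finset.mem_insert_self a s)
    rcases s.eq_empty_or_nonempty with rfl | hs
    -- With a single column left there is nothing to rotate against; `U` is diagonal with at most
    -- one nontrivial entry, which the determinant fixes.
    · have hd : U = Matrix.diagonal (Function.update 1 a (U a a)) := by
        ext i j
        by_cases hj : j = a
        · subst hj
          by_cases hi : i = j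
          · subst hi; simp
          · rw [hsupp i (by simpa using hi), Matrix.diagonal_apply_ne _ hi]
        · rw [h j (by simpa using hj) i]
          by_cases hi : i = j
          · subst hi; simp [hj]
          · rw [Matrix.diagonal_apply_ne _ hi, Matrix.one_apply_ne hi]
      have hdet := hU'.2
      rw [hd, Matrix.det_diagonal, Finset.prod_update_of_mem (Finset.mem_univ a)] at hdet
      simp only [Pi.one_apply, Finset.prod_const_one, mul_one] at hdet
      rw [hd, hdet]
      have : Function.update (1 : ι → ℂ) a 1 = 1 := Function.update_eq_self a (1 : ι → ℂ)
      rw [this]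
      convert one_mem G
      exact Matrix.diagonal_one
    · obtain ⟨g, hg, hgG, hgw, hgs, hgt, hgr⟩ := exists_mulVec_eq_zero hG
        (Finset.mem_insert_self a s) (fun i => U i a) hsupp s
        (fun x hx => Finset.mem_erase.2 ⟨fun e => has (e ▸ hx), Finset.mem_insert_of_mem hx⟩)
      obtain ⟨r, hr, hra⟩ := hgr hs
      have hgU : g * U ∈ Matrix.specialUnitaryGroup ι ℂ := mul_mem hg hU
      have hgU' := Matrix.mem_specialUnitaryGroup_iff.1 hgU
      have hoff : ∀ i, i ≠ a → (g * U) i a = 0 := by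
        intro i hi
        change (g *ᵥ fun j => U j a) i = 0
        by_cases his : i ∈ s
        · exact hgt i his
        · exact hgs i (by simp [hi, his])
      have hra' : (g * U) a a = r := hra
      have h1 : star (g * U) * (g * U) = 1 := Matrix.mem_unitaryGroup_iff'.1 hgU'.1
      have hrr := congrFun (congrFun h1 a) a
      rw [Matrix.mul_apply, Finset.sum_eq_single a] at hrr
      · rw [Matrix.star_eq_conjTranspose, Matrix.conjTranspose_apply, hra', Matrix.one_apply_eq,
          RCLike.star_def, conj_ofReal, ← ofReal_mul, ← ofReal_one, ofReal_inj] at hrr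
        have hr1 : r = 1 := by nlinarith
        have hmem : g * U ∈ G := by
          refine ih _ hgU fun x hx i => ?_
          by_cases hxa : x = a
          · subst hxa
            by_cases hi : i = x
            · subst hi; rw [hra', hr1]; simp
            · rw [hoff i hi, Matrix.one_apply_ne hi]
          · have hx' : x ∉ insert a s := by simp [hxa, hx]
            have hcol : (fun j => U j x) = fun j => (1 : Matrix ι ι ℂ) j x :=
              funext fun j => h x hx' j
            change (g *ᵥ fun j => U j x) i = _
            rw [hcol, hgw]
            intro y hy
            exact Matrix.one_apply_ne (fun e => hx' (e ▸ hy))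
        have hg1 : star g * g = 1 :=
          Matrix.mem_unitaryGroup_iff'.1 (Matrix.mem_specialUnitaryGroup_iff.1 hg).1
        have : U = star g * (g * U) := by rw [← mul_assoc, hg1, one_mul]
        rw [this]
        exact mul_mem hgG hmem
      · intro j _ hj
        rw [hoff j hj, mul_zero]
      · simp

/-- The special unitary two-level operators generate the special unitary group. -/
theorem specialUnitaryGroup_le_of_twoLevel_mem {G : Submonoid (Matrix ι ι ℂ)}
    (hG : ∀ x y : ι, x ≠ y → ∀ A ∈ Matrix.specialUnitaryGroup (Fin 2) ℂ,
      twoLevel ![x, y] A ∈ G) : Matrix.specialUnitaryGroup ι ℂ ≤ G :=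
  fun U hU => specialUnitary_mem_of_fixed hG Finset.univ U hU (by simp)

/-- A unitary matrix is special unitary up to a phase. -/
theorem exists_smul_mem_specialUnitaryGroup [Nonempty ι] {U : Matrix ι ι ℂ}
    (hU : U ∈ Matrix.unitaryGroup ι ℂ) :
    ∃ c : ℂ, ‖c‖ = 1 ∧ c • U ∈ Matrix.specialUnitaryGroup ι ℂ := by
  have hdet : ‖U.det‖ = 1 := by
    have h := congrArg Matrix.det (Matrix.mem_unitaryGroup_iff.1 hU)
    rw [Matrix.det_mul, Matrix.star_eq_conjTranspose, Matrix.det_conjTranspose, Matrix.det_one,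
      RCLike.star_def, mul_conj] at h
    have h' : normSq U.det = 1 := by exact_mod_cast h
    rw [normSq_eq_norm_sq] at h'
    nlinarith [norm_nonneg U.det]
  -- Scaling by `c` multiplies the determinant by `c` to the power of the dimension, so a root of
  -- the inverse determinant is needed.
  obtain ⟨c, hc⟩ := IsAlgClosed.exists_pow_nat_eq (U.det)⁻¹ (Fintype.card_pos (α := ι))
  have hc1 : ‖c‖ = 1 := by
    have h := congrArg norm hc
    rw [norm_pow, norm_inv, hdet, inv_one] at h
    exact (pow_eq_one_iff_of_nonneg (norm_nonneg c) Fintype.card_ne_zero).1 h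
  refine ⟨c, hc1, Matrix.mem_specialUnitaryGroup_iff.2 ⟨?_, ?_⟩⟩
  · rw [Matrix.mem_unitaryGroup_iff, star_smul, smul_mul_smul_comm,
      Matrix.mem_unitaryGroup_iff.1 hU, RCLike.star_def, mul_conj, normSq_eq_norm_sq, hc1]
    simp
  · rw [Matrix.det_smul, hc, inv_mul_cancel₀]
    intro h0
    rw [h0, norm_zero] at hdet
    exact zero_ne_one hdet

end TwoLevel

/-! ### Multiplexed one-qubit operators -/

section Multiplexer

variable {n : ℕ}

/-- The bit strings on the slots other than `l`. -/
abbrev OtherBits (l : Fin n) := {j : Fin n // j ≠ l} → Fin 2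

/-- The operator acting on slot `l` by `F w`, where `w` is the bit string on the other slots. -/
def multiplexer (l : Fin n) : (OtherBits l → OneBit) →+* QOp n :=
  (Matrix.reindexRingEquiv ℂ (Equiv.funSplitAt l (Fin 2)).symm : _ →+* _).comp
    (Matrix.blockDiagonalRingHom (Fin 2) (OtherBits l) ℂ)

theorem multiplexer_apply (l : Fin n) (F : OtherBits l → OneBit) (y x : Bits n) :
    multiplexer l F y x =
      if ∀ i, i ≠ l → y i = x i then F (fun j => x j) (y l) (x l) else 0 := by
  have h : ((fun j => y j : OtherBits l) = (fun j => x j : OtherBits l)) ↔ ∀ i, i ≠ l → y i = x i := by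
    simp [funext_iff]
  simp only [multiplexer, RingHom.comp_apply, RingEquiv.coe_toRingHom,
    Matrix.coe_reindexRingEquiv, Matrix.reindex_apply, Matrix.submatrix_apply,
    Matrix.blockDiagonalRingHom_apply, Equiv.symm_symm, Equiv.funSplitAt_apply,
    Matrix.blockDiagonal_apply']
  by_cases hh : ∀ i, i ≠ l → y i = x i
  · rw [if_pos hh, if_pos (h.2 hh), h.2 hh]
  · rw [if_neg hh, if_neg (mt h.1 hh)]

/-- Since `multiplexer` is a ring homomorphism, products of gates with a common target can be
checked separately for each bit string on the other slots. -/
theorem onQubit_eq_multiplexer (l : Fin n) (A : OneBit) :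
    onQubit l A = multiplexer l fun _ => A := by
  ext y x
  rw [multiplexer_apply]; rfl

theorem onQubit_one (l : Fin n) : onQubit l 1 = 1 := by
  rw [onQubit_eq_multiplexer]; exact map_one _

theorem onQubit_mul (l : Fin n) (A B : OneBit) :
    onQubit l (A * B) = onQubit l A * onQubit l B := by
  simp only [onQubit_eq_multiplexer, ← map_mul]; rfl

theorem onQubit_smul_one (l : Fin n) (c : ℂ) : onQubit l (c • (1 : OneBit)) = c • 1 := by
  ext y x
  have h : (∀ i, i ≠ l → y i = x i) ∧ y l = x l ↔ y = x :=
    ⟨fun h => funext fun i => by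
      by_cases hi : i = l
      · rw [hi]; exact h.2
      · exact h.1 i hi, fun h => by simp [h]⟩
  simp only [onQubit, Matrix.of_apply, Matrix.smul_apply, Matrix.one_apply, ← h]
  split_ifs <;> simp_all

/-- The operator `A` on slot `l` controlled by the predicate `P` on the other slots. -/
noncomputable def controlledBy (l : Fin n) (P : OtherBits l → Prop) (A : OneBit) : OtherBits l → OneBit :=
  open Classical in fun w => if P w then A else 1

theorem controlledBy_mul (l : Fin n) (P : OtherBits l → Prop) (A B : OneBit) :
    controlledBy l P A * controlledBy l P B = controlledBy l P (A * B) := by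
  ext1 w
  by_cases h : P w <;> simp [controlledBy, h]

theorem onPair_controlled {l m : Fin n} (hlm : l ≠ m) (A : OneBit) :
    onPair l m (controlled A) = multiplexer m (controlledBy m (fun w => w ⟨l, hlm⟩ = 1) A) := by
  ext y x
  rw [multiplexer_apply]
  have h : (∀ i, i ≠ m → y i = x i) ↔ (∀ i, i ≠ l → i ≠ m → y i = x i) ∧ y l = x l :=
    ⟨fun h => ⟨fun i _ hi => h i hi, h l hlm⟩, fun h i hi => by
      by_cases hl : i = l
      · rw [hl]; exact h.2
      · exact h.1 i hl hi⟩
  simp only [onPair, controlled, controlledBy, Matrix.of_apply, h]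
  by_cases h1 : ∀ i, i ≠ l → i ≠ m → y i = x i
  · by_cases h2 : y l = x l
    · by_cases h3 : x l = 1 <;> simp [h1, h2, h3, Matrix.one_apply]
    · simp [h2]
  · simp [h1]

/-! ### Identities for rotations and the structure of SU(2). -/

/-- The Pauli matrix `σ_z`. -/
def sigmaZ : OneBit := !![1, 0; 0, -1]

theorem phaseGate_pi : phaseGate Real.pi = controlled sigmaZ := by
  ext ⟨a, b⟩ ⟨c, d⟩
  have h : exp (I * Real.pi) = -1 := by rw [mul_comm, exp_pi_mul_I]
  fin_cases a <;> fin_cases b <;> fin_cases c <;> fin_cases d <;>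
    simp [phaseGate, controlled, sigmaZ, Matrix.diagonal_apply, h]

theorem rotationGate_mul_neg (θ φ : ℝ) : rotationGate θ φ * rotationGate (-θ) φ = 1 := by
  have h1 : exp (I * φ) * exp (-(I * φ)) = 1 := by rw [← exp_add]; simp
  have h2 : (Real.cos θ : ℂ) ^ 2 + (Real.sin θ : ℂ) ^ 2 = 1 := by
    exact_mod_cast Real.cos_sq_add_sin_sq θ
  have h3 := I_sq
  simp only [rotationGate, Real.cos_neg, Real.sin_neg, ofReal_neg]
  generalize exp (I * φ) = u at *
  generalize exp (-(I * φ)) = v at *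
  generalize (Real.cos θ : ℂ) = c at *
  generalize (Real.sin θ : ℂ) = s at *
  ext i j
  fin_cases i <;> fin_cases j <;> simp [Matrix.mul_apply, Fin.sum_univ_two]
  · linear_combination h2 + s ^ 2 * h1 - s ^ 2 * u * v * h3
  · ring
  · ring
  · linear_combination h2 + s ^ 2 * h1 - s ^ 2 * u * v * h3

/-- `sigmaZ` commutes with the diagonal part and anticommutes with the off-diagonal part. -/
theorem sigmaZ_conj_rotationGate (θ φ : ℝ) :
    sigmaZ * rotationGate θ φ * sigmaZ = rotationGate (-θ) φ := by
  ext i j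
  fin_cases i <;> fin_cases j <;>
    simp [sigmaZ, rotationGate, Matrix.mul_apply, Fin.sum_univ_two]

theorem rotationGate_mul_self (θ φ : ℝ) :
    rotationGate θ φ * rotationGate θ φ = rotationGate (2 * θ) φ := by
  have h1 : exp (I * φ) * exp (-(I * φ)) = 1 := by rw [← exp_add]; simp
  have h3 := I_sq
  have h4 : (Real.cos (2 * θ) : ℂ) = (Real.cos θ : ℂ) ^ 2 - (Real.sin θ : ℂ) ^ 2 := by
    rw [Real.cos_two_mul']; push_cast; rfl
  have h5 : (Real.sin (2 * θ) : ℂ) = 2 * (Real.sin θ : ℂ) * (Real.cos θ : ℂ) := by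
    rw [Real.sin_two_mul]; push_cast; rfl
  simp only [rotationGate, h4, h5]
  generalize exp (I * φ) = u at *
  generalize exp (-(I * φ)) = v at *
  generalize (Real.cos θ : ℂ) = c at *
  generalize (Real.sin θ : ℂ) = s at *
  ext i j
  fin_cases i <;> fin_cases j <;> simp [Matrix.mul_apply, Fin.sum_univ_two]
  · linear_combination - s ^ 2 * h1 + s ^ 2 * u * v * h3
  · ring
  · ring
  · linear_combination - s ^ 2 * h1 + s ^ 2 * u * v * h3

theorem rotationGate_mem_specialUnitaryGroup (θ φ : ℝ) :
    rotationGate θ φ ∈ Matrix.specialUnitaryGroup (Fin 2) ℂ := by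
  have hs : star (rotationGate θ φ) = rotationGate (-θ) φ := by
    ext i j
    fin_cases i <;> fin_cases j <;>
      simp [rotationGate, Matrix.star_eq_conjTranspose, ← exp_conj, -ofReal_sin, -ofReal_cos]
  rw [Matrix.mem_specialUnitaryGroup_iff, Matrix.mem_unitaryGroup_iff, hs, rotationGate_mul_neg]
  refine ⟨rfl, ?_⟩
  have h1 : exp (I * φ) * exp (-(I * φ)) = 1 := by rw [← exp_add]; simp
  have h2 : (Real.cos θ : ℂ) ^ 2 + (Real.sin θ : ℂ) ^ 2 = 1 := by
    exact_mod_cast Real.cos_sq_add_sin_sq θ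
  rw [rotationGate, Matrix.det_fin_two_of]
  linear_combination h2 - (Real.sin θ : ℂ) ^ 2 * exp (I * φ) * exp (-(I * φ)) * I_sq +
    (Real.sin θ : ℂ) ^ 2 * h1

/-- For determinant one the adjugate is the inverse, hence the conjugate transpose, and this
expresses the second column through the first. -/
theorem specialUnitary_ext {A B : OneBit} (hA : A ∈ Matrix.specialUnitaryGroup (Fin 2) ℂ)
    (hB : B ∈ Matrix.specialUnitaryGroup (Fin 2) ℂ) (h : ∀ i, A i 0 = B i 0) : A = B := by
  have key : ∀ C ∈ Matrix.specialUnitaryGroup (Fin 2) ℂ,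
      C 1 1 = star (C 0 0) ∧ C 0 1 = -star (C 1 0) := by
    intro C hC
    rw [Matrix.mem_specialUnitaryGroup_iff] at hC
    have h1 : C * star C = 1 := Matrix.mem_unitaryGroup_iff.1 hC.1
    have h2 : C.adjugate * C = 1 := by rw [Matrix.adjugate_mul, hC.2, one_smul]
    have h3 : C.adjugate = star C := left_inv_eq_right_inv h2 h1
    rw [Matrix.adjugate_fin_two] at h3
    have h00 := congrFun (congrFun h3 0) 0
    have h01 := congrFun (congrFun h3 0) 1
    simp only [Matrix.star_eq_conjTranspose, Matrix.conjTranspose_apply, Matrix.of_apply,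
      Matrix.cons_val', Matrix.cons_val_zero, Matrix.cons_val_one] at h00 h01
    exact ⟨h00, by rw [← h01, neg_neg]⟩
  have hA' := key A hA
  have hB' := key B hB
  ext i j
  fin_cases j
  · exact h i
  · fin_cases i
    · change A 0 1 = B 0 1
      rw [hA'.2, hB'.2, h 1]
    · change A 1 1 = B 1 1
      rw [hA'.1, hB'.1, h 0]

/-- Every special unitary `2 × 2` matrix is a product of three rotation gates. -/
theorem exists_rotationGate_mul {A : OneBit} (hA : A ∈ Matrix.specialUnitaryGroup (Fin 2) ℂ) :
    ∃ θ φ α : ℝ, A = rotationGate (Real.pi / 2) α *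
      rotationGate (Real.pi / 2) (Real.pi) * rotationGate θ φ := by
  have hA' := Matrix.mem_specialUnitaryGroup_iff.1 hA
  have h1 : star A * A = 1 := Matrix.mem_unitaryGroup_iff'.1 hA'.1
  have hn : ‖A 0 0‖ ^ 2 + ‖A 1 0‖ ^ 2 = 1 := by
    have h := congrFun (congrFun h1 0) 0
    simp only [Matrix.mul_apply, Fin.sum_univ_two, Matrix.star_eq_conjTranspose,
      Matrix.conjTranspose_apply, RCLike.star_def, Matrix.one_apply_eq] at h
    rw [mul_comm, mul_conj, mul_comm, mul_conj, normSq_eq_norm_sq, normSq_eq_norm_sq] at h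
    exact_mod_cast h
  obtain ⟨θ, hc, hs⟩ : ∃ θ : ℝ, Real.cos θ = ‖A 0 0‖ ∧ Real.sin θ = ‖A 1 0‖ := by
    refine ⟨Real.arccos ‖A 0 0‖, Real.cos_arccos (by linarith [norm_nonneg (A 0 0)]) ?_, ?_⟩
    · nlinarith [norm_nonneg (A 0 0), sq_nonneg ‖A 1 0‖]
    · rw [Real.sin_arccos, show 1 - ‖A 0 0‖ ^ 2 = ‖A 1 0‖ ^ 2 by linarith,
        Real.sqrt_sq (norm_nonneg _)]
  -- The two half-pi rotations multiply to `diag (e^{-iα}, e^{iα})`, which supplies the phase of `A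
  -- 0 0`. In `φ`, the term `π/2` cancels the factor `-i` of the rotation and `arg (A 0 0)` cancels
  -- the second diagonal entry.
  refine ⟨θ, (A 1 0).arg + (A 0 0).arg + Real.pi / 2, -(A 0 0).arg, ?_⟩
  refine specialUnitary_ext hA (mul_mem (mul_mem (rotationGate_mem_specialUnitaryGroup _ _)
    (rotationGate_mem_specialUnitaryGroup _ _)) (rotationGate_mem_specialUnitaryGroup _ _)) ?_
  have e1 : exp (I * Real.pi) = -1 := by rw [mul_comm, exp_pi_mul_I]
  have e2 : exp (-(I * Real.pi)) = -1 := by rw [exp_neg, e1]; norm_num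
  have e3 : exp (I * (Real.pi / 2)) = I := by rw [mul_comm, exp_pi_div_two_mul_I]
  have e4 : exp (I * (A 0 0).arg) * exp (-(I * (A 0 0).arg)) = 1 := by rw [← exp_add]; simp
  have a0 := norm_mul_exp_arg_mul_I (A 0 0)
  have a1 := norm_mul_exp_arg_mul_I (A 1 0)
  have h3 := I_sq
  rw [mul_comm _ I] at a0 a1
  intro i
  fin_cases i
  · simp [Matrix.mul_apply, Fin.sum_univ_two, rotationGate, hc, hs, e1, e2, -ofReal_cos,
      -ofReal_sin]
    linear_combination -a0 + ‖A 0 0‖ * exp (I * (A 0 0).arg) * h3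
  · simp [Matrix.mul_apply, Fin.sum_univ_two, rotationGate, hc, hs, e1, e2, e3, -ofReal_cos,
      -ofReal_sin, mul_add, exp_add]
    linear_combination -a1 - ‖A 1 0‖ * exp (I * (A 1 0).arg) * e4 - ‖A 1 0‖ * exp (I * (A 1 0).arg) *
      exp (I * (A 0 0).arg) * exp (-(I * (A 0 0).arg)) * (I ^ 2 - 1) * h3

end Multiplexer

/-! ### Universality -/

section Universality

theorem twoLevel_apply_embedding {ι : Type*} [Fintype ι] [DecidableEq ι] {e : Fin 2 → ι}
    (he : Function.Injective e) (A : OneBit) (a b : Fin 2) : twoLevel e A (e a) (e b) = A a b := by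
  simp [twoLevel, levelEmbedding, Matrix.mul_apply, Matrix.one_apply, he.eq_iff]

theorem twoLevel_apply_of_ne_left {ι : Type*} [Fintype ι] [DecidableEq ι] {e : Fin 2 → ι}
    (A : OneBit) {i : ι} (hi : ∀ a, i ≠ e a) (j : ι) :
    twoLevel e A i j = (1 : Matrix ι ι ℂ) i j := by
  simp [twoLevel, levelEmbedding, Matrix.mul_apply, Matrix.one_apply, hi]

theorem twoLevel_apply_of_ne_right {ι : Type*} [Fintype ι] [DecidableEq ι] {e : Fin 2 → ι}
    (A : OneBit) (i : ι) {j : ι} (hj : ∀ a, j ≠ e a) :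
    twoLevel e A i j = (1 : Matrix ι ι ℂ) i j := by
  simp [twoLevel, levelEmbedding, Matrix.mul_apply, Matrix.one_apply, fun a => (hj a).symm]

variable {n : ℕ}

/-- The fully controlled one-qubit operators are the two-level operators along the edges of the
hypercube. -/
theorem multiplexer_controlledBy_eq_twoLevel (l : Fin n) (x : Bits n) (A : OneBit) :
    multiplexer l (controlledBy l (fun w => ∀ k, w k = x k) A) =
      twoLevel ![Function.update x l 0, Function.update x l 1] A := by
  have he : ![Function.update x l 0, Function.update x l 1] =
      fun a : Fin 2 => Function.update x l a := by
    funext a; fin_cases a <;> rfl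
  have hinj : Function.Injective fun a : Fin 2 => Function.update x l a :=
    Function.update_injective x l
  have hmem : ∀ z : Bits n, (∀ k, k ≠ l → z k = x k) → z = Function.update x l (z l) := by
    intro z hz
    funext k
    by_cases hk : k = l
    · subst hk; simp
    · simp [hk, hz k hk]
  have hnot : ∀ z : Bits n, ¬ (∀ k, k ≠ l → z k = x k) → ∀ a, z ≠ Function.update x l a := by
    rintro z hz a rfl
    exact hz fun k hk => by simp [hk]
  rw [he]
  ext y z
  rw [multiplexer_apply]
  simp only [controlledBy, Subtype.forall]
  by_cases hz : ∀ k, k ≠ l → z k = x k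
  · rw [if_pos hz]
    by_cases hy : ∀ k, k ≠ l → y k = x k
    · rw [if_pos fun k hk => (hy k hk).trans (hz k hk).symm]
      conv_rhs => rw [hmem y hy, hmem z hz]
      exact (twoLevel_apply_embedding hinj A _ _).symm
    · rw [twoLevel_apply_of_ne_left A (hnot y hy), if_neg, Matrix.one_apply_ne]
      · rintro rfl; exact hy hz
      · exact fun h => hy fun k hk => (h k hk).trans (hz k hk)
  · rw [twoLevel_apply_of_ne_right A y (hnot z hz), if_neg hz]
    by_cases hyz : y = z
    · subst hyz; simp
    · rw [Matrix.one_apply_ne hyz]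
      split_ifs with h
      · rw [Matrix.one_apply_ne]
        intro h'
        apply hyz
        funext k
        by_cases hk : k = l
        · rw [hk, h']
        · exact h k hk
      · rfl

theorem onQubit_mem_of_rotations {G : Submonoid (QOp n)}
    (hR : ∀ (θ φ : ℝ) (l : Fin n), onQubit l (rotationGate θ φ) ∈ G) (l : Fin n) {A : OneBit}
    (hA : A ∈ Matrix.specialUnitaryGroup (Fin 2) ℂ) : onQubit l A ∈ G := by
  obtain ⟨θ, φ, α, rfl⟩ := exists_rotationGate_mul hA
  rw [onQubit_mul, onQubit_mul]
  exact mul_mem (mul_mem (hR _ _ _) (hR _ _ _)) (hR _ _ _)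

theorem controlledBy_mem_of_rotations {G : Submonoid (QOp n)} {l : Fin n} {P : OtherBits l → Prop}
    (h : ∀ θ φ : ℝ, multiplexer l (controlledBy l P (rotationGate θ φ)) ∈ G) {A : OneBit}
    (hA : A ∈ Matrix.specialUnitaryGroup (Fin 2) ℂ) : multiplexer l (controlledBy l P A) ∈ G := by
  obtain ⟨θ, φ, α, rfl⟩ := exists_rotationGate_mul hA
  rw [← controlledBy_mul, ← controlledBy_mul, map_mul, map_mul]
  exact mul_mem (mul_mem (h _ _) (h _ _)) (h _ _)

theorem sigmaZ_mul_self : sigmaZ * sigmaZ = 1 := by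
  ext i j; fin_cases i <;> fin_cases j <;> simp [sigmaZ]

/-- The commutator of a rotation with `σ_z` is the rotation by twice the angle. -/
theorem rotationGate_commutator (θ φ : ℝ) :
    rotationGate (θ / 2) φ * sigmaZ * rotationGate (-(θ / 2)) φ * sigmaZ = rotationGate θ φ := by
  rw [mul_assoc, mul_assoc, ← mul_assoc sigmaZ, sigmaZ_conj_rotationGate, neg_neg,
    rotationGate_mul_self]
  congr 1; ring

/-- Two phase gates interleaved with rotations by `θ/2` and `-θ/2` give rotation by `θ` when the
control is 1, and cancellation when it is 0. -/
theorem controlled_rotation_mem {G : Submonoid (QOp n)}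
    (hR : ∀ (θ φ : ℝ) (l : Fin n), onQubit l (rotationGate θ φ) ∈ G)
    (hQ : ∀ l m : Fin n, l ≠ m → onPair l m (phaseGate Real.pi) ∈ G)
    (l : Fin n) (k : {j : Fin n // j ≠ l}) (b : Fin 2) {A : OneBit}
    (hA : A ∈ Matrix.specialUnitaryGroup (Fin 2) ℂ) :
    multiplexer l (controlledBy l (fun w => w k = b) A) ∈ G := by
  have h1 : ∀ {A : OneBit}, A ∈ Matrix.specialUnitaryGroup (Fin 2) ℂ →
      multiplexer l (controlledBy l (fun w => w k = 1) A) ∈ G := by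
    intro A hA
    refine controlledBy_mem_of_rotations (fun θ φ => ?_) hA
    have hZ := hQ k l k.2
    rw [phaseGate_pi, onPair_controlled k.2] at hZ
    have h2 := hR (θ / 2) φ l
    have h3 := hR (-(θ / 2)) φ l
    rw [onQubit_eq_multiplexer] at h2 h3
    convert mul_mem (mul_mem (mul_mem h2 hZ) h3) hZ using 1
    rw [← map_mul, ← map_mul, ← map_mul]
    congr 1
    ext1 w
    simp only [Pi.mul_apply, controlledBy]
    split_ifs
    · exact (rotationGate_commutator θ φ).symm
    · rw [mul_one, mul_one, rotationGate_mul_neg]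
  by_cases hb : b = 1
  · subst hb; exact h1 hA
  · have hb' : b = 0 := by omega
    subst hb'
    -- Control on the value 0: apply `A` unconditionally and undo it when the control is 1.
    have hs : star A ∈ Matrix.specialUnitaryGroup (Fin 2) ℂ :=
      (star (⟨A, hA⟩ : Matrix.specialUnitaryGroup (Fin 2) ℂ)).2
    have hAs : A * star A = 1 :=
      Matrix.mem_unitaryGroup_iff.1 (Matrix.mem_specialUnitaryGroup_iff.1 hA).1
    have h2 := onQubit_mem_of_rotations hR l hA
    rw [onQubit_eq_multiplexer] at h2
    convert mul_mem h2 (h1 hs) using 1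
    rw [← map_mul]
    congr 1
    ext1 w
    have : w k = 0 ∨ w k = 1 := by omega
    rcases this with h | h <;> simp [controlledBy, h, hAs]

/-- A commutator of a `K`-controlled rotation with a `k`-controlled `σ_z` is nontrivial only if both
controls hold, so it adds `k` to the control set. -/
theorem multicontrolled_mem {G : Submonoid (QOp n)}
    (hR : ∀ (θ φ : ℝ) (l : Fin n), onQubit l (rotationGate θ φ) ∈ G)
    (hQ : ∀ l m : Fin n, l ≠ m → onPair l m (phaseGate Real.pi) ∈ G)
    (l : Fin n) (x : Bits n) (K : Finset {j : Fin n // j ≠ l}) : ∀ {A : OneBit},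
    A ∈ Matrix.specialUnitaryGroup (Fin 2) ℂ →
    multiplexer l (controlledBy l (fun w => ∀ k ∈ K, w k = x k) A) ∈ G := by
  induction K using Finset.induction_on with
  | empty =>
    intro A hA
    have h := onQubit_mem_of_rotations hR l hA
    rw [onQubit_eq_multiplexer] at h
    convert h using 2
    ext1 w
    simp [controlledBy]
  | insert k K hk ih =>
    intro A hA
    refine controlledBy_mem_of_rotations (fun θ φ => ?_) hA
    -- The factor `I` gives `sigmaZ` determinant one, as `controlled_rotation_mem` requires; it
    -- cancels against `-I` in the commutator.
    have hIZ : I • sigmaZ ∈ Matrix.specialUnitaryGroup (Fin 2) ℂ := by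
      rw [Matrix.mem_specialUnitaryGroup_iff, Matrix.mem_unitaryGroup_iff]
      constructor
      · ext i j
        fin_cases i <;> fin_cases j <;>
          simp [sigmaZ, Matrix.mul_apply, Fin.sum_univ_two, Matrix.star_eq_conjTranspose]
      · simp [sigmaZ, Matrix.det_fin_two]
    have hIZ' : (-I) • sigmaZ ∈ Matrix.specialUnitaryGroup (Fin 2) ℂ := by
      convert (star (⟨_, hIZ⟩ : Matrix.specialUnitaryGroup (Fin 2) ℂ)).2 using 1
      change _ = star (I • sigmaZ)
      ext i j
      fin_cases i <;> fin_cases j <;> simp [sigmaZ, Matrix.star_eq_conjTranspose]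
    have h1 := ih (rotationGate_mem_specialUnitaryGroup (θ / 2) φ)
    have h2 := ih (rotationGate_mem_specialUnitaryGroup (-(θ / 2)) φ)
    have h3 := controlled_rotation_mem hR hQ l k (x k) hIZ
    have h4 := controlled_rotation_mem hR hQ l k (x k) hIZ'
    convert mul_mem (mul_mem (mul_mem h1 h3) h2) h4 using 1
    rw [← map_mul, ← map_mul, ← map_mul]
    congr 1
    ext1 w
    have hII : (I • sigmaZ) * ((-I) • sigmaZ) = 1 := by
      rw [smul_mul_smul_comm, sigmaZ_mul_self]; simp
    simp only [Pi.mul_apply, controlledBy, Finset.forall_mem_insert]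
    by_cases hw : w k = x k <;> by_cases hK : ∀ k ∈ K, w k = x k
    · rw [if_pos ⟨hw, hK⟩, if_pos hK, if_pos hw, if_pos hK, if_pos hw]
      simp only [Matrix.mul_smul, Matrix.smul_mul, smul_smul]
      rw [rotationGate_commutator]
      simp
    · rw [if_neg (fun h => hK h.2), if_neg hK, if_neg hK, if_pos hw, if_pos hw, one_mul, mul_one,
        hII]
    · rw [if_neg (fun h => hw h.1), if_pos hK, if_pos hK, if_neg hw, if_neg hw, mul_one, mul_one,
        rotationGate_mul_neg]
    · rw [if_neg (fun h => hw h.1), if_neg hK, if_neg hK, if_neg hw, if_neg hw]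
      simp

/-- The rotations together with the phase gate generate the special unitary group. -/
theorem specialUnitaryGroup_le_of_gates_mem {G : Submonoid (QOp n)}
    (hR : ∀ (θ φ : ℝ) (l : Fin n), onQubit l (rotationGate θ φ) ∈ G)
    (hQ : ∀ l m : Fin n, l ≠ m → onPair l m (phaseGate Real.pi) ∈ G) :
    Matrix.specialUnitaryGroup (Bits n) ℂ ≤ G := by
  have hedge : ∀ (x : Bits n) (l : Fin n), ∀ A ∈ Matrix.specialUnitaryGroup (Fin 2) ℂ,
      twoLevel ![Function.update x l 0, Function.update x l 1] A ∈ G := by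
    intro x l A hA
    rw [← multiplexer_controlledBy_eq_twoLevel]
    simpa using multicontrolled_mem hR hQ l x Finset.univ hA
  let r : Bits n → Bits n → Prop := fun x y =>
    ∀ A ∈ Matrix.specialUnitaryGroup (Fin 2) ℂ, twoLevel ![x, y] A ∈ G
  have hstep : ∀ (x : Bits n) (l : Fin n) (b : Fin 2),
      x = Function.update x l b ∨ r x (Function.update x l b) := by
    intro x l b
    by_cases h : x l = b
    · left; subst h; simp
    · right
      have hx : x = Function.update x l (x l) := by simp
      have h0 : r (Function.update x l 0) (Function.update x l 1) := hedge x l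
      have h1 : r (Function.update x l 1) (Function.update x l 0) := twoLevel_mem_symm h0
      have : (x l = 0 ∧ b = 1) ∨ (x l = 1 ∧ b = 0) := by omega
      rcases this with ⟨ha, rfl⟩ | ⟨ha, rfl⟩
      · rw [ha] at hx; rw [← hx] at h0; exact h0
      · rw [ha] at hx; rw [← hx] at h1; exact h1
  -- The bits of `x` are changed into those of `y` one at a time, along edges of the hypercube. The
  -- equality alternative covers bits that already agree.
  have hall : ∀ (x y : Bits n) (S : Finset (Fin n)),
      x = S.piecewise y x ∨ r x (S.piecewise y x) := by
    intro x y S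
    induction S using Finset.induction_on with
    | empty => left; simp
    | insert l S hl ih =>
      rw [Finset.piecewise_insert]
      generalize S.piecewise y x = z at ih
      have hz := hstep z l (y l)
      generalize Function.update z l (y l) = z' at hz
      by_cases hxz' : x = z'
      · exact Or.inl hxz'
      · right
        rcases ih with rfl | ih
        · exact hz.resolve_left hxz'
        · rcases hz with rfl | hz
          · exact ih
          · by_cases hxz : x = z
            · subst hxz; exact hz
            by_cases hzz : z = z'
            · subst hzz; exact ih
            exact twoLevel_mem_trans hxz hzz hxz' ih hz
  refine specialUnitaryGroup_le_of_twoLevel_mem fun x y hxy => ?_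
  have h := hall x y Finset.univ
  rw [Finset.piecewise_univ] at h
  exact h.resolve_left hxy

/-- By periodicity the range of the angles is no restriction, so half and negative angles are
available. -/
theorem rotationGate_mem_rotations (θ φ : ℝ) : rotationGate θ φ ∈ rotations := by
  have hp := Real.two_pi_pos
  have hθ := toIcoMod_mem_Ico hp 0 θ
  have hφ := toIcoMod_mem_Ico hp 0 φ
  rw [zero_add] at hθ hφ
  refine ⟨toIcoMod hp 0 θ, ⟨hθ.1, hθ.2.le⟩, toIcoMod hp 0 φ, ⟨hφ.1, hφ.2.le⟩, ?_⟩
  have h1 : Real.cos (toIcoMod hp 0 θ) = Real.cos θ := by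
    rw [toIcoMod, zsmul_eq_mul, Real.cos_sub_int_mul_two_pi]
  have h2 : Real.sin (toIcoMod hp 0 θ) = Real.sin θ := by
    rw [toIcoMod, zsmul_eq_mul, Real.sin_sub_int_mul_two_pi]
  have h3 : exp (I * (toIcoMod hp 0 φ : ℝ)) = exp (I * φ) := by
    rw [toIcoMod, zsmul_eq_mul]
    push_cast
    rw [mul_sub, exp_sub, show I * ((toIcoDiv hp 0 φ : ℂ) * (2 * Real.pi)) =
      (toIcoDiv hp 0 φ : ℂ) * (2 * Real.pi * I) by ring, exp_int_mul_two_pi_mul_I, div_one]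
  simp only [rotationGate, h1, h2, exp_neg, h3]

/-! ### Conjugacy of CNOT and the phase gate; universality up to phase. -/

theorem rotationGate_quarter_mul :
    rotationGate (Real.pi / 4) (Real.pi / 2) * rotationGate (Real.pi / 4) (-(Real.pi / 2)) = 1 := by
  have h : rotationGate (Real.pi / 4) (-(Real.pi / 2)) =
      rotationGate (-(Real.pi / 4)) (Real.pi / 2) := by
    have e3 : exp (I * (Real.pi / 2)) = I := by rw [mul_comm, exp_pi_div_two_mul_I]
    simp [rotationGate, exp_neg, e3]
  rw [h, rotationGate_mul_neg]

theorem rotationGate_quarter_mul' :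
    rotationGate (Real.pi / 4) (-(Real.pi / 2)) * rotationGate (Real.pi / 4) (Real.pi / 2) = 1 :=
  mul_eq_one_comm.1 rotationGate_quarter_mul

theorem rotationGate_quarter_conj_sigmaZ :
    rotationGate (Real.pi / 4) (Real.pi / 2) * sigmaZ *
      rotationGate (Real.pi / 4) (-(Real.pi / 2)) = sigmaX := by
  have e3 : exp (I * (Real.pi / 2)) = I := by rw [mul_comm, exp_pi_div_two_mul_I]
  have hs : ((Real.sqrt 2 : ℝ) : ℂ) * (Real.sqrt 2 : ℝ) = 2 := by
    rw [← ofReal_mul, Real.mul_self_sqrt (by norm_num)]; norm_num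
  ext i j
  fin_cases i <;> fin_cases j <;>
    simp [rotationGate, sigmaZ, sigmaX, exp_neg, e3, Matrix.mul_apply, Fin.sum_univ_two,
      -ofReal_cos, -ofReal_sin, Real.cos_pi_div_four, Real.sin_pi_div_four] <;>
    linear_combination (1 / 2 : ℂ) * hs

/-- The CNOT gate is conjugate to the phase gate. -/
theorem onPair_cnot {l m : Fin n} (hlm : l ≠ m) :
    onPair l m cnot =
      onQubit m (rotationGate (Real.pi / 4) (Real.pi / 2)) * onPair l m (phaseGate Real.pi) *
        onQubit m (rotationGate (Real.pi / 4) (-(Real.pi / 2))) := by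
  rw [phaseGate_pi, cnot, onPair_controlled hlm, onPair_controlled hlm, onQubit_eq_multiplexer,
    onQubit_eq_multiplexer, ← map_mul, ← map_mul]
  congr 1
  ext1 w
  simp only [Pi.mul_apply, controlledBy]
  split_ifs
  · exact rotationGate_quarter_conj_sigmaZ.symm
  · rw [mul_one, rotationGate_quarter_mul]

theorem onPair_phaseGate_pi {l m : Fin n} (hlm : l ≠ m) :
    onPair l m (phaseGate Real.pi) =
      onQubit m (rotationGate (Real.pi / 4) (-(Real.pi / 2))) * onPair l m cnot *
        onQubit m (rotationGate (Real.pi / 4) (Real.pi / 2)) := by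
  have h : onQubit m (rotationGate (Real.pi / 4) (-(Real.pi / 2))) *
      onQubit m (rotationGate (Real.pi / 4) (Real.pi / 2)) = 1 := by
    rw [← onQubit_mul, rotationGate_quarter_mul', onQubit_one]
  rw [onPair_cnot hlm, mul_assoc, mul_assoc, h, mul_one, ← mul_assoc, h, one_mul]

theorem onQubit_mem_compositions {S₁ : Set OneBit} {S₂ : Set TwoBit} {A : OneBit} (hA : A ∈ S₁)
    (l : Fin n) : onQubit l A ∈ compositions S₁ S₂ n :=
  Submonoid.subset_closure (Or.inl ⟨A, hA, l, rfl⟩)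

theorem onPair_mem_compositions {S₁ : Set OneBit} {S₂ : Set TwoBit} {B : TwoBit} (hB : B ∈ S₂)
    {l m : Fin n} (hlm : l ≠ m) : onPair l m B ∈ compositions S₁ S₂ n :=
  Submonoid.subset_closure (Or.inr ⟨B, hB, l, m, hlm, rfl⟩)

theorem isUniversalUpToPhase_of_le {S₁ : Set OneBit} {S₂ : Set TwoBit}
    (h : ∀ n : ℕ, 2 ≤ n → Matrix.specialUnitaryGroup (Bits n) ℂ ≤ compositions S₁ S₂ n) :
    IsUniversalUpToPhase S₁ S₂ := by
  refine fun n hn => ⟨fun U hU => h n hn hU, fun U hU => ?_⟩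
  obtain ⟨c, hc, hcU⟩ := exists_smul_mem_specialUnitaryGroup hU
  exact ⟨c, hc, h n hn hcU⟩

theorem isUniversalUpToPhase_phaseGate : IsUniversalUpToPhase rotations {phaseGate Real.pi} :=
  isUniversalUpToPhase_of_le fun _ _ => specialUnitaryGroup_le_of_gates_mem
    (fun θ φ l => onQubit_mem_compositions (rotationGate_mem_rotations θ φ) l)
    (fun _ _ hlm => onPair_mem_compositions (Set.mem_singleton _) hlm)

theorem isUniversalUpToPhase_cnot : IsUniversalUpToPhase rotations {cnot} :=
  isUniversalUpToPhase_of_le fun _ _ => specialUnitaryGroup_le_of_gates_mem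
    (fun θ φ l => onQubit_mem_compositions (rotationGate_mem_rotations θ φ) l)
    (fun l m hlm => by
      rw [onPair_phaseGate_pi hlm]
      exact mul_mem (mul_mem (onQubit_mem_compositions (rotationGate_mem_rotations _ _) m)
        (onPair_mem_compositions (Set.mem_singleton _) hlm))
        (onQubit_mem_compositions (rotationGate_mem_rotations _ _) m))

end Universality

/-! ### Time evolutions exchanging pairs of basis vectors -/

section Evolution

variable {N : ℕ}

theorem inner_ket (c d : Config N) : ⟪ket c, ket d⟫_ℂ = if c = d then 1 else 0 := by
  rw [ket, lp.inner_single_left, ket, lp.single_apply, Pi.single_apply]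
  split_ifs <;> simp

theorem dense_span_ket :
    (⊤ : Submodule ℂ (TrapSpace N)) ≤ (Submodule.span ℂ (Set.range ket)).topologicalClosure := by
  let b : HilbertBasis (Config N) ℂ (TrapSpace N) :=
    HilbertBasis.ofRepr (LinearIsometryEquiv.refl ℂ _)
  have hb : ⇑b = (ket : Config N → TrapSpace N) := by
    funext c
    rw [← b.repr_symm_single c]; rfl
  rw [← hb]
  exact b.dense_span.ge

theorem isometryEquiv_ext {V W : TrapSpace N ≃ₗᵢ[ℂ] TrapSpace N}
    (h : ∀ c, V (ket c) = W (ket c)) : V = W := by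
  have hd : Dense (Submodule.span ℂ (Set.range (ket : Config N → TrapSpace N)) :
      Set (TrapSpace N)) :=
    (Submodule.dense_iff_topologicalClosure_eq_top).2 (top_le_iff.1 dense_span_ket)
  have h' : (V.toContinuousLinearEquiv : TrapSpace N →L[ℂ] TrapSpace N) =
      (W.toContinuousLinearEquiv : TrapSpace N →L[ℂ] TrapSpace N) := by
    refine ContinuousLinearMap.ext_on hd ?_
    rintro _ ⟨c, rfl⟩
    exact h c
  ext1 ψ
  exact DFunLike.congr_fun h' ψ

/-- A family of unitary operators depending continuously on the parameter on the basis vectors is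
strongly continuous. -/
theorem continuous_apply_of_ket {V : ℝ → (TrapSpace N ≃ₗᵢ[ℂ] TrapSpace N)}
    (h : ∀ c, Continuous fun t => V t (ket c)) (ψ : TrapSpace N) :
    Continuous fun t => V t ψ := by
  have hspan : ∀ x ∈ Submodule.span ℂ (Set.range (ket : Config N → TrapSpace N)),
      Continuous fun t => V t x := by
    intro x hx
    induction hx using Submodule.span_induction with
    | mem x hx => obtain ⟨c, rfl⟩ := hx; exact h c
    | zero => simpa using continuous_const
    | add x y _ _ hx hy => simp only [map_add]; exact hx.add hy
    | smul a x _ hx => simp only [map_smul]; exact hx.const_smul a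
  have hψ : ψ ∈ closure (Submodule.span ℂ (Set.range (ket : Config N → TrapSpace N)) :
      Set (TrapSpace N)) := dense_span_ket (Submodule.mem_top (x := ψ))
  -- Each `V t` is an isometry, so approximating `ψ` by a finite combination costs the same error
  -- for all `t`: the orbit is a uniform limit of continuous ones.
  refine continuous_of_uniform_approx_of_continuous fun u hu => ?_
  obtain ⟨ε, hε, hεu⟩ := Metric.mem_uniformity_dist.1 hu
  obtain ⟨x, hx, hxε⟩ := Metric.mem_closure_iff.1 hψ ε hε
  exact ⟨fun t => V t x, hspan x hx, fun t => hεu (by rwa [(V t).dist_map])⟩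

variable {σ : Config N → Config N} {ω : Config N → ℝ} {p : Config N → ℂ}

/-- The image of `|c⟩` under the evolution exchanging `|c⟩` and `|σ c⟩`. -/
noncomputable def evolvedKet (σ : Config N → Config N) (ω : Config N → ℝ) (p : Config N → ℂ)
    (t : ℝ) (c : Config N) : TrapSpace N :=
  (Real.cos (ω c * t) : ℂ) • ket c + (-(I * (Real.sin (ω c * t) : ℂ) * p c)) • ket (σ c)

theorem cos_sq_add_sin_sq_ofReal (x : ℝ) : (Real.cos x : ℂ) ^ 2 + (Real.sin x : ℂ) ^ 2 = 1 := by
  exact_mod_cast Real.cos_sq_add_sin_sq x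

/-- On the span of `c` and `σ c` the Hamiltonian is `ω` times a Hermitian matrix of square one,
whose exponential is `cos - i sin` times that matrix. -/
theorem orthonormal_evolvedKet (hσ : Function.Involutive σ) (hω : ∀ c, ω (σ c) = ω c)
    (hp : ∀ c, p (σ c) = (starRingEnd ℂ) (p c)) (hp1 : ∀ c, ‖p c‖ = 1) (t : ℝ) :
    Orthonormal ℂ (evolvedKet σ ω p t) := by
  have hpp : ∀ c, (starRingEnd ℂ) (p c) * p c = 1 := by
    intro c
    rw [mul_comm, mul_conj, normSq_eq_norm_sq, hp1]; simp
  rw [orthonormal_iff_ite]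
  intro c d
  simp only [evolvedKet, inner_add_left, inner_add_right, inner_smul_left, inner_smul_right,
    inner_ket, conj_ofReal, map_neg, map_mul, conj_I, hσ.injective.eq_iff, hσ.eq_iff]
  have hcos := cos_sq_add_sin_sq_ofReal (ω c * t)
  have e1 : (c = σ d) ↔ (σ c = d) := (hσ.eq_iff).symm
  simp only [e1]
  by_cases hcd : c = d
  · subst hcd
    by_cases hc : σ c = c
    · have h1 := hp c
      rw [hc] at h1
      simp only [hc, if_true, ← h1]
      have h2 := hpp c
      rw [← h1] at h2
      linear_combination hcos - (Real.sin (ω c * t) : ℂ) ^ 2 * p c * p c * I_sq +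
        (Real.sin (ω c * t) : ℂ) ^ 2 * h2
    · simp only [hc, if_true, if_false]
      linear_combination hcos - (Real.sin (ω c * t) : ℂ) ^ 2 * ((starRingEnd ℂ) (p c) * p c) *
        I_sq + (Real.sin (ω c * t) : ℂ) ^ 2 * hpp c
  · by_cases hc : σ c = d
    · subst hc
      simp only [hcd, if_true, if_false, hω, hp]
      ring
    · simp [hcd, hc]

/-- Running the evolution backwards expresses each `ket c` through the evolved kets of `c` and `σ
c`. -/
theorem dense_span_evolvedKet (hσ : Function.Involutive σ) (hω : ∀ c, ω (σ c) = ω c)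
    (hp : ∀ c, p (σ c) = (starRingEnd ℂ) (p c)) (hp1 : ∀ c, ‖p c‖ = 1) (t : ℝ) :
    (⊤ : Submodule ℂ (TrapSpace N)) ≤
      (Submodule.span ℂ (Set.range (evolvedKet σ ω p t))).topologicalClosure := by
  have hpp : ∀ c, p c * (starRingEnd ℂ) (p c) = 1 := by
    intro c
    rw [mul_conj, normSq_eq_norm_sq, hp1]; simp
  refine dense_span_ket.trans (Submodule.topologicalClosure_mono ?_)
  rw [Submodule.span_le]
  rintro _ ⟨c, rfl⟩
  have h : (ket c : TrapSpace N) = (Real.cos (ω c * t) : ℂ) • evolvedKet σ ω p t c +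
      (I * (Real.sin (ω c * t) : ℂ) * p c) • evolvedKet σ ω p t (σ c) := by
    simp only [evolvedKet, hσ c, hω, hp, smul_add, smul_smul]
    have hcos := cos_sq_add_sin_sq_ofReal (ω c * t)
    push_cast at hcos ⊢
    match_scalars
    · linear_combination -hcos + Complex.sin (ω c * t) ^ 2 * (p c * (starRingEnd ℂ) (p c)) *
        I_sq - Complex.sin (ω c * t) ^ 2 * hpp c
    · ring
  rw [h]
  exact Submodule.add_mem _ (Submodule.smul_mem _ _ (Submodule.subset_span ⟨c, rfl⟩))
    (Submodule.smul_mem _ _ (Submodule.subset_span ⟨σ c, rfl⟩))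

/-- A Hamiltonian exchanging the basis vectors in pairs, with frequency `ω` and phase `p`, has an
explicit time evolution. -/
theorem exists_isTimeEvolution {hbar : ℝ} (hhbar : hbar ≠ 0) (hσ : Function.Involutive σ)
    (hω : ∀ c, ω (σ c) = ω c) (hp : ∀ c, p (σ c) = (starRingEnd ℂ) (p c)) (hp1 : ∀ c, ‖p c‖ = 1)
    {H : FiniteState N →ₗ[ℂ] FiniteState N}
    (hH : ∀ c, H (Finsupp.single c 1) = Finsupp.single (σ c) ((hbar : ℂ) * (ω c : ℂ) * p c)) :
    ∃ V : ℝ → (TrapSpace N ≃ₗᵢ[ℂ] TrapSpace N), IsTimeEvolution hbar H V ∧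
      ∀ t c, V t (ket c) = evolvedKet σ ω p t c := by
  have hpp : ∀ c, p c * (starRingEnd ℂ) (p c) = 1 := by
    intro c
    rw [mul_conj, normSq_eq_norm_sq, hp1]; simp
  -- The unitary carrying the standard Hilbert basis to the evolved one; no exponential of the
  -- possibly unbounded `H` is needed.
  let V : ℝ → (TrapSpace N ≃ₗᵢ[ℂ] TrapSpace N) := fun t =>
    (HilbertBasis.mk (orthonormal_evolvedKet hσ hω hp hp1 t)
      (dense_span_evolvedKet hσ hω hp hp1 t)).repr.symm
  have hV : ∀ t c, V t (ket c) = evolvedKet σ ω p t c := by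
    intro t c
    have h := HilbertBasis.repr_symm_single (HilbertBasis.mk (orthonormal_evolvedKet hσ hω hp hp1 t)
      (dense_span_evolvedKet hσ hω hp hp1 t)) c
    rw [HilbertBasis.coe_mk] at h
    exact h
  refine ⟨V, ⟨fun s t => ?_, continuous_apply_of_ket fun c => ?_, fun f => ?_⟩, hV⟩
  · refine isometryEquiv_ext fun c => ?_
    rw [LinearIsometryEquiv.coe_mul, Function.comp_apply, hV t, hV (s + t), evolvedKet, evolvedKet,
      map_add, map_smul, map_smul, hV, hV, evolvedKet, evolvedKet, hσ c, hω, hp, mul_add,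
      Real.cos_add, Real.sin_add]
    push_cast
    simp only [smul_add, smul_smul]
    match_scalars
    · linear_combination (norm := ring_nf) -(Complex.sin (ω c * s)) * Complex.sin (ω c * t) *
        (p c * (starRingEnd ℂ) (p c)) * I_sq +
        (Complex.sin (ω c * s)) * Complex.sin (ω c * t) * hpp c
    · ring
  · simp only [hV, evolvedKet]
    fun_prop
  · induction f using Finsupp.induction_linear with
    | zero => simpa using hasDerivAt_const (0 : ℝ) (0 : TrapSpace N)
    | add f g hf hg => simp only [map_add, smul_add]; exact hf.add hg
    | single c a =>
      have h1 : toTrapSpace (Finsupp.single c a) = a • (ket c : TrapSpace N) := by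
        simp [toTrapSpace]
      have h2 : H (Finsupp.single c a) =
          a • Finsupp.single (σ c) ((hbar : ℂ) * (ω c : ℂ) * p c) := by
        rw [← hH, ← map_smul, Finsupp.smul_single_one]
      have h3 : toTrapSpace (H (Finsupp.single c a)) =
          (a * ((hbar : ℂ) * (ω c : ℂ) * p c)) • (ket (σ c) : TrapSpace N) := by
        rw [h2, map_smul, toTrapSpace, Finsupp.linearCombination_single, smul_smul]
      rw [h1, h3]
      simp only [map_smul, hV, evolvedKet]
      have hlin : HasDerivAt (fun t : ℝ => ω c * t) (ω c) 0 := by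
        simpa using (hasDerivAt_id (0 : ℝ)).const_mul (ω c)
      have hcos := (hlin.cos.ofReal_comp).smul_const (ket c : TrapSpace N)
      have hsin := (((hlin.sin.ofReal_comp).const_mul I).mul_const (p c)).neg.smul_const
        (ket (σ c) : TrapSpace N)
      have hb : (hbar : ℂ) ≠ 0 := by exact_mod_cast hhbar
      have heq : (-(I / (hbar : ℂ))) • (a * ((hbar : ℂ) * (ω c : ℂ) * p c)) •
          (ket (σ c) : TrapSpace N) = a • (((-Real.sin (ω c * 0) * ω c : ℝ) : ℂ) • ket c +
          (-(I * ((Real.cos (ω c * 0) * ω c : ℝ) : ℂ) * p c)) • ket (σ c)) := by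
        simp only [mul_zero, Real.sin_zero, Real.cos_zero, neg_zero, zero_mul, ofReal_zero,
          zero_smul, zero_add, one_mul, smul_smul]
        congr 1
        field_simp
      rw [heq]
      exact (hcos.add hsin).const_smul a

end Evolution

/-! ### Laser pulses -/

section Pulses

variable {N : ℕ}

/-- The configuration coupled to a given one by the laser resonant with the qubit transition. -/
def carrierPartner (j : Fin N) (c : Config N) : Config N :=
  (Function.update c.1 j (Equiv.swap (some 0) (some 1) (c.1 j)), c.2)

theorem level_cases (q : IonLevel) : q = some 0 ∨ q = some 1 ∨ q = none := by
  rcases q with _ | q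
  · exact Or.inr (Or.inr rfl)
  · fin_cases q
    · exact Or.inl rfl
    · exact Or.inr (Or.inl rfl)

theorem update_eq_of_apply_eq {α β : Type*} [DecidableEq α] {f : α → β} {j : α} {b : β}
    (h : f j = b) : Function.update f j b = f := by
  rw [← h, Function.update_eq_self]

theorem exists_carrier_evolution {hbar Ω : ℝ} (hhbar : hbar ≠ 0) (j : Fin N) (φ : ℝ) :
    ∃ V : ℝ → (TrapSpace N ≃ₗᵢ[ℂ] TrapSpace N),
      IsTimeEvolution hbar (carrierHamiltonian hbar Ω j φ) V ∧
      (∀ (t : ℝ) (X : Fin N → IonLevel) (k : ℕ), X j = some 0 → V t (ket (X, k)) =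
        (Real.cos (Ω / 2 * t) : ℂ) • ket (X, k) + (I * (Real.sin (Ω / 2 * t) : ℂ) *
          exp (-(I * φ))) • ket (Function.update X j (some 1), k)) ∧
      (∀ (t : ℝ) (X : Fin N → IonLevel) (k : ℕ), X j = some 1 → V t (ket (X, k)) =
        (Real.cos (Ω / 2 * t) : ℂ) • ket (X, k) + (I * (Real.sin (Ω / 2 * t) : ℂ) *
          exp (I * φ)) • ket (Function.update X j (some 0), k)) := by
  -- The frequency absorbs the minus sign of the Hamiltonian. The auxiliary level is uncoupled:
  -- frequency 0, and 1 as an arbitrary phase.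
  let ω : Config N → ℝ := fun c => if c.1 j = none then 0 else -(Ω / 2)
  let p : Config N → ℂ := fun c =>
    if c.1 j = some 0 then exp (-(I * φ)) else if c.1 j = some 1 then exp (I * φ) else 1
  have hsw : Equiv.swap (some 0) (some 1) (none : IonLevel) = none :=
    Equiv.swap_apply_of_ne_of_ne (by simp) (by simp)
  have hσ : Function.Involutive (carrierPartner j) := by
    intro c
    simp [carrierPartner]
  have hω : ∀ c, ω (carrierPartner j c) = ω c := by
    intro c
    rcases level_cases (c.1 j) with h | h | h <;> simp [ω, carrierPartner, h, hsw]
  have hp : ∀ c, p (carrierPartner j c) = (starRingEnd ℂ) (p c) := by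
    intro c
    rcases level_cases (c.1 j) with h | h | h <;>
      simp [p, carrierPartner, h, hsw, ← exp_conj]
  have hp1 : ∀ c, ‖p c‖ = 1 := by
    intro c
    have h1 : ‖exp (I * φ)‖ = 1 := by rw [mul_comm, norm_exp_ofReal_mul_I]
    rcases level_cases (c.1 j) with h | h | h <;> simp [p, h, exp_neg, h1]
  obtain ⟨V, hV, hVk⟩ := exists_isTimeEvolution hhbar hσ hω hp hp1
    (H := carrierHamiltonian hbar Ω j φ) (by
      rintro ⟨X, k⟩
      rcases level_cases (X j) with h | h | h <;>
        simp [carrierHamiltonian, ketBra, carrierPartner, h, hsw, ω, p, -Finsupp.single_mul,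
          -Finsupp.single_neg] <;> try rw [← Finsupp.single_neg]
      all_goals congr 1; ring)
  refine ⟨V, hV, fun t X k h => ?_, fun t X k h => ?_⟩
  · rw [hVk, evolvedKet]
    simp [carrierPartner, h, ω, p, -ofReal_cos, -ofReal_sin]
  · rw [hVk, evolvedKet]
    simp [carrierPartner, h, ω, p, -ofReal_cos, -ofReal_sin]

/-- The configuration coupled to a given one by the laser on the red sideband of the transition
between the levels `0` and `u`. -/
def sidebandPartner (u : IonLevel) (j : Fin N) (c : Config N) : Config N :=
  if c.1 j = some 0 then (if c.2 = 0 then c else (Function.update c.1 j u, c.2 - 1))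
  else if c.1 j = u then (Function.update c.1 j (some 0), c.2 + 1) else c

/-- The pairs are `|0⟩|k⟩` and `|u⟩|k-1⟩`, coupled with strength proportional to `√k`; `|0⟩|0⟩` has
no partner because `a` kills it. The gates only visit at most one phonon. -/
theorem exists_sideband_evolution {hbar η Ω : ℝ} (hhbar : hbar ≠ 0) {u : IonLevel}
    (hu : u ≠ some 0) (j : Fin N) (φ : ℝ) :
    ∃ V : ℝ → (TrapSpace N ≃ₗᵢ[ℂ] TrapSpace N),
      IsTimeEvolution hbar (sidebandHamiltonian hbar η Ω u j φ) V ∧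
      (∀ (t : ℝ) (X : Fin N → IonLevel), X j = some 0 → V t (ket (X, 0)) = ket (X, 0)) ∧
      (∀ (t : ℝ) (X : Fin N → IonLevel) (k : ℕ), X j ≠ some 0 → X j ≠ u →
        V t (ket (X, k)) = ket (X, k)) ∧
      (∀ (t : ℝ) (X : Fin N → IonLevel), X j = some 0 → V t (ket (X, 1)) =
        (Real.cos (η * Ω / (2 * Real.sqrt N) * t) : ℂ) • ket (X, 1) +
        (-(I * (Real.sin (η * Ω / (2 * Real.sqrt N) * t) : ℂ) * exp (-(I * φ)))) •
          ket (Function.update X j u, 0)) ∧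
      (∀ (t : ℝ) (X : Fin N → IonLevel), X j = u → V t (ket (X, 0)) =
        (Real.cos (η * Ω / (2 * Real.sqrt N) * t) : ℂ) • ket (X, 0) +
        (-(I * (Real.sin (η * Ω / (2 * Real.sqrt N) * t) : ℂ) * exp (I * φ))) •
          ket (Function.update X j (some 0), 1)) := by
  set g : ℝ := η * Ω / (2 * Real.sqrt N) with hg
  -- The two branches agree on each pair, since `|u⟩|k⟩` is partnered with `|0⟩|k+1⟩`.
  let ω : Config N → ℝ := fun c =>
    if c.1 j = some 0 then g * Real.sqrt c.2
    else if c.1 j = u then g * Real.sqrt (c.2 + 1) else 0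
  let p : Config N → ℂ := fun c =>
    -- At the fixed point `|0⟩|0⟩` the phase must be real; its value does not affect the evolution,
    -- the frequency there being 0.
    if c.1 j = some 0 then (if c.2 = 0 then 1 else exp (-(I * φ)))
    else if c.1 j = u then exp (I * φ) else 1
  have hσ : Function.Involutive (sidebandPartner u j) := by
    rintro ⟨X, k⟩
    by_cases h0 : X j = some 0
    · rcases k with _ | k
      · simp [sidebandPartner, h0]
      · simp [sidebandPartner, h0, hu, update_eq_of_apply_eq h0]
    · by_cases h1 : X j = u
      · simp [sidebandPartner, h1, hu, update_eq_of_apply_eq h1]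
      · simp [sidebandPartner, h0, h1]
  have hω : ∀ c, ω (sidebandPartner u j c) = ω c := by
    rintro ⟨X, k⟩
    by_cases h0 : X j = some 0
    · rcases k with _ | k
      · simp [ω, sidebandPartner, h0]
      · simp [ω, sidebandPartner, h0, hu]
    · by_cases h1 : X j = u
      · simp [ω, sidebandPartner, h1, hu]
      · simp [ω, sidebandPartner, h0, h1]
  have hp : ∀ c, p (sidebandPartner u j c) = (starRingEnd ℂ) (p c) := by
    rintro ⟨X, k⟩
    by_cases h0 : X j = some 0
    · rcases k with _ | k
      · simp [p, sidebandPartner, h0]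
      · simp [p, sidebandPartner, h0, hu, ← exp_conj]
    · by_cases h1 : X j = u
      · simp [p, sidebandPartner, h1, hu, ← exp_conj]
      · simp [p, sidebandPartner, h0, h1]
  have hp1 : ∀ c, ‖p c‖ = 1 := by
    have h1 : ‖exp (I * φ)‖ = 1 := by rw [mul_comm, norm_exp_ofReal_mul_I]
    intro c
    simp only [p]
    split_ifs <;> simp [exp_neg, h1]
  obtain ⟨V, hV, hVk⟩ := exists_isTimeEvolution hhbar hσ hω hp hp1
    (H := sidebandHamiltonian hbar η Ω u j φ) (by
      have hgc : ((hbar * η * Ω / (2 * Real.sqrt N) : ℝ) : ℂ) = hbar * g := by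
        rw [hg, ← ofReal_mul]; congr 1; ring
      rintro ⟨X, k⟩
      simp only [sidebandHamiltonian, hgc]
      have h0u : some 0 ≠ u := hu.symm
      by_cases h0 : X j = some 0
      · rcases k with _ | k
        · simp [ketBra, annihilation, creation, sidebandPartner, h0, h0u, ω, p]
        · simp [ketBra, annihilation, creation, sidebandPartner, h0, h0u, ω, p,
            -Finsupp.single_mul]
          congr 1; ring
      · by_cases h1 : X j = u
        · simp [ketBra, annihilation, creation, sidebandPartner, h1, hu, ω, p,
            -Finsupp.single_mul]
          congr 1; ring
        · simp [ketBra, annihilation, creation, sidebandPartner, h0, h1, ω, p])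
  refine ⟨V, hV, fun t X h => ?_, fun t X k h h' => ?_, fun t X h => ?_, fun t X h => ?_⟩ <;>
    rw [hVk, evolvedKet]
  · simp [sidebandPartner, h, ω, p]
  · simp [sidebandPartner, h, h', ω, p]
  · simp [sidebandPartner, h, ω, p, -ofReal_cos, -ofReal_sin]
  · simp [sidebandPartner, h, hu, ω, p, -ofReal_cos, -ofReal_sin]

end Pulses

/-! ### Gates implemented by pulses -/

section Implementation

variable {N : ℕ}

/-- The first sequence returns the phonon mode to its ground state, so the second acts by linearity
on register states again. -/
theorem Implements.mul {W₁ W₂ : TrapSpace N ≃ₗᵢ[ℂ] TrapSpace N} {U₁ U₂ : QOp N}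
    (h₁ : Implements W₁ U₁) (h₂ : Implements W₂ U₂) : Implements (W₁ * W₂) (U₁ * U₂) := by
  intro x
  rw [LinearIsometryEquiv.coe_mul, Function.comp_apply, h₂ x, map_sum]
  simp only [map_smul, h₁ _, Finset.smul_sum, smul_smul, Matrix.mul_apply, Finset.sum_smul]
  rw [Finset.sum_comm]
  simp only [mul_comm]

/-- The operators that can be implemented exactly by laser pulses. -/
def realizableOperators (hbar η Ω : ℝ) (N : ℕ) : Submonoid (QOp N) where
  carrier := {U | IonRealizable hbar η Ω U}
  one_mem' := ⟨1, one_mem _, fun x => by simp [Matrix.one_apply]⟩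
  mul_mem' := fun ⟨W₁, hW₁, h₁⟩ ⟨W₂, hW₂, h₂⟩ => ⟨W₁ * W₂, mul_mem hW₁ hW₂, h₁.mul h₂⟩

theorem registerKet_eq (x : Bits N) : registerKet x = ket (fun i => some (x i), 0) := rfl

theorem ket_update_eq_registerKet (x : Bits N) (l : Fin N) (a : Fin 2) :
    (ket (Function.update (fun i => some (x i)) l (some a), 0) : TrapSpace N) =
      registerKet (Function.update x l a) := by
  rw [registerKet_eq]
  congr 2
  funext i
  by_cases hi : i = l
  · subst hi; simp
  · simp [hi]

theorem sum_onQubit_smul (l : Fin N) (A : OneBit) (x : Bits N) (f : Bits N → TrapSpace N) :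
    ∑ y, onQubit l A y x • f y = ∑ a, A a (x l) • f (Function.update x l a) := by
  symm
  refine Fintype.sum_of_injective (fun a => Function.update x l a)
    (Function.update_injective x l) _ _ ?_ ?_
  · intro y hy
    have : onQubit l A y x = 0 := by
      rw [onQubit, Matrix.of_apply, if_neg]
      intro h
      refine hy ⟨y l, ?_⟩
      funext i
      by_cases hi : i = l
      · subst hi; simp
      · simp [hi, h i hi]
    rw [this, zero_smul]
  · intro a
    have : onQubit l A (Function.update x l a) x = A a (x l) := by
      rw [onQubit, Matrix.of_apply, if_pos]
      · simp
      · intro i hi; simp [hi]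
    rw [this]

theorem sum_onPair_phaseGate_smul {l m : Fin N} (hlm : l ≠ m) (x : Bits N)
    (f : Bits N → TrapSpace N) :
    ∑ y, onPair l m (phaseGate Real.pi) y x • f y =
      (if x l = 1 ∧ x m = 1 then (-1 : ℂ) else 1) • f x := by
  rw [phaseGate_pi, onPair_controlled hlm]
  have h : multiplexer m (controlledBy m (fun w => w ⟨l, hlm⟩ = 1) sigmaZ) =
      Matrix.diagonal fun x => if x l = 1 ∧ x m = 1 then (-1 : ℂ) else 1 := by
    ext y z
    rw [multiplexer_apply, Matrix.diagonal_apply]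
    by_cases hyz : y = z
    · subst hyz
      have : y m = 0 ∨ y m = 1 := by omega
      rcases this with h | h <;> by_cases hl : y l = 1 <;> simp [controlledBy, sigmaZ, h, hl]
    · rw [if_neg hyz]
      split_ifs with h
      · have hm : y m ≠ z m := by
          intro hm
          apply hyz
          funext i
          by_cases hi : i = m
          · rw [hi, hm]
          · exact h i hi
        have : (y m = 0 ∧ z m = 1) ∨ (y m = 1 ∧ z m = 0) := by omega
        rcases this with ⟨h1, h2⟩ | ⟨h1, h2⟩ <;> by_cases hl : z l = 1 <;>
          simp [controlledBy, sigmaZ, h1, h2, hl]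
      · rfl
  rw [h, Finset.sum_eq_single x]
  · rw [Matrix.diagonal_apply_eq]
  · intro y _ hy
    rw [Matrix.diagonal_apply_ne _ hy, zero_smul]
  · simp

/-- A resonant pulse implements a rotation gate. -/
theorem exists_carrier_implements {hbar Ω : ℝ} (hhbar : hbar ≠ 0) (hΩ : Ω ≠ 0) (l : Fin N)
    (θ φ : ℝ) : ∃ V : ℝ → (TrapSpace N ≃ₗᵢ[ℂ] TrapSpace N),
      IsTimeEvolution hbar (carrierHamiltonian hbar Ω l (Real.pi - φ)) V ∧
      Implements (V (2 * θ / Ω)) (onQubit l (rotationGate θ φ)) := by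
  obtain ⟨V, hV, h0, h1⟩ := exists_carrier_evolution (Ω := Ω) hhbar l (Real.pi - φ)
  refine ⟨V, hV, fun x => ?_⟩
  have hθ : Ω / 2 * (2 * θ / Ω) = θ := by field_simp
  -- The `π` turns the `+i` of the resonant evolution into the `-i` of the gate; the sign of `φ`
  -- compensates the opposite phase convention of the Hamiltonian.
  have e1 : exp (I * ((Real.pi - φ : ℝ) : ℂ)) = -exp (-(I * φ)) := by
    push_cast
    rw [mul_sub, sub_eq_add_neg, exp_add, mul_comm I (Real.pi : ℂ), exp_pi_mul_I, neg_one_mul]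
  have e2 : exp (-(I * ((Real.pi - φ : ℝ) : ℂ))) = -exp (I * φ) := by
    rw [exp_neg, e1, exp_neg, inv_neg, inv_inv]
  rw [sum_onQubit_smul, Fin.sum_univ_two]
  have hx : x l = 0 ∨ x l = 1 := by omega
  rcases hx with hx | hx
  · rw [registerKet_eq, h0 _ _ _ (by rw [hx]), ket_update_eq_registerKet, ← registerKet_eq, hx,
      update_eq_of_apply_eq hx, hθ, e2]
    simp only [rotationGate, Matrix.of_apply, Matrix.cons_val', Matrix.cons_val_zero,
      Matrix.cons_val_one]
    congr 2
    ring
  · rw [registerKet_eq, h1 _ _ _ (by rw [hx]), ket_update_eq_registerKet, ← registerKet_eq, hx,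
      update_eq_of_apply_eq hx, hθ, e1, add_comm]
    simp only [rotationGate, Matrix.of_apply, Matrix.cons_val', Matrix.cons_val_zero,
      Matrix.cons_val_one]
    congr 2
    ring

/-- This duration transfers one excitation completely between ion and phonon; twice it is a full
cycle, with sign -1. -/
theorem sideband_half_period {η Ω : ℝ} (hη : η ≠ 0) (hΩ : Ω ≠ 0) (hN : 0 < N) :
    η * Ω / (2 * Real.sqrt N) * (Real.pi / (η * Ω) * Real.sqrt N) = Real.pi / 2 := by
  have : Real.sqrt N ≠ 0 := (Real.sqrt_pos.2 (by exact_mod_cast hN)).ne'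
  field_simp

/-- Three sideband pulses implement the phase gate. -/
theorem exists_sideband_implements {hbar η Ω : ℝ} (hhbar : hbar ≠ 0) (hη : η ≠ 0) (hΩ : Ω ≠ 0)
    {l m : Fin N} (hlm : l ≠ m) {T : ℝ} (hT : T = Real.pi / (η * Ω) * Real.sqrt N) :
    ∃ V V' : ℝ → (TrapSpace N ≃ₗᵢ[ℂ] TrapSpace N),
      IsTimeEvolution hbar (qubitSideband hbar η Ω l 0) V ∧
      IsTimeEvolution hbar (auxSideband hbar η Ω m 0) V' ∧
      Implements (V T * V' (2 * T) * V T) (onPair l m (phaseGate Real.pi)) := by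
  obtain ⟨V, hV, a1, -, a3, a4⟩ := exists_sideband_evolution (η := η) (Ω := Ω) hhbar
    (u := some 1) (by simp) l 0
  obtain ⟨V', hV', b1, b2, b3, -⟩ := exists_sideband_evolution (η := η) (Ω := Ω) hhbar
    (u := none) (by simp) m 0
  refine ⟨V, V', hV, hV', fun x => ?_⟩
  have hg : η * Ω / (2 * Real.sqrt N) * T = Real.pi / 2 := by
    rw [hT]; exact sideband_half_period hη hΩ l.pos
  have hg2 : η * Ω / (2 * Real.sqrt N) * (2 * T) = Real.pi := by linarith
  rw [sum_onPair_phaseGate_smul hlm, LinearIsometryEquiv.coe_mul, LinearIsometryEquiv.coe_mul,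
    Function.comp_apply, Function.comp_apply, registerKet_eq]
  set X : Fin N → IonLevel := fun i => some (x i) with hX
  have hxl : x l = 0 ∨ x l = 1 := by omega
  have hxm : x m = 0 ∨ x m = 1 := by omega
  rcases hxl with hxl | hxl
  -- No phonon is created, so none of the three pulses acts.
  · have hXl : X l = some 0 := by simp [hX, hxl]
    have hV'X : V' (2 * T) (ket (X, 0)) = ket (X, 0) := by
      rcases hxm with hxm | hxm
      · exact b1 _ _ (by simp [hX, hxm])
      · exact b2 _ _ _ (by simp [hX, hxm]) (by simp [hX])
    rw [a1 _ _ hXl, hV'X, a1 _ _ hXl]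
    simp [hxl]
  -- The outer pulses contribute `(-i)² = -1`. The middle one contributes another -1 if ion `m` is
  -- in level 0, and nothing if it is in level 1, which is uncoupled.
  · have hXl : X l = some 1 := by simp [hX, hxl]
    have h1 : V T (ket (X, 0)) = (-I) • ket (Function.update X l (some 0), 1) := by
      rw [a4 _ _ hXl, hg]; simp
    have h3 : V T (ket (Function.update X l (some 0), 1)) = (-I) • ket (X, 0) := by
      rw [a3 _ _ (by simp), hg, Function.update_idem, update_eq_of_apply_eq hXl]; simp
    have hm : Function.update X l (some 0) m = some (x m) := by
      simp [hX, hlm.symm]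
    rw [h1, map_smul]
    rcases hxm with hxm | hxm
    · have h2 : V' (2 * T) (ket (Function.update X l (some 0), 1)) =
          (-1 : ℂ) • ket (Function.update X l (some 0), 1) := by
        rw [b3 _ _ (by rw [hm, hxm]), hg2]; simp
      rw [h2, map_smul, map_smul, h3]
      simp [hxl, hxm, smul_smul]
    · have h2 : V' (2 * T) (ket (Function.update X l (some 0), 1)) =
          ket (Function.update X l (some 0), 1) :=
        b2 _ _ _ (by simp [hm, hxm]) (by simp [hm])
      rw [h2, map_smul, h3]
      simp [hxl, hxm, smul_smul]

variable {hbar η Ω : ℝ}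

theorem rotationGate_realizable (hhbar : 0 < hbar) (hΩ : 0 < Ω) (l : Fin N) (θ φ : ℝ) :
    onQubit l (rotationGate θ φ) ∈ realizableOperators hbar η Ω N := by
  -- Angles in the fundamental range make the pulse duration nonnegative.
  obtain ⟨θ', hθ', φ', -, h⟩ := rotationGate_mem_rotations θ φ
  rw [h]
  obtain ⟨V, hV, hI⟩ := exists_carrier_implements hhbar.ne' hΩ.ne' l θ' φ'
  exact ⟨_, Submonoid.subset_closure ⟨l, Real.pi - φ', 2 * θ' / Ω, _, V,
    div_nonneg (mul_nonneg zero_le_two hθ'.1) hΩ.le, Or.inl rfl, hV, rfl⟩, hI⟩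

theorem half_period_nonneg (hη : 0 < η) (hΩ : 0 < Ω) :
    0 ≤ Real.pi / (η * Ω) * Real.sqrt N := by
  have := Real.pi_pos
  positivity

theorem phaseGate_realizable (hhbar : 0 < hbar) (hη : 0 < η) (hΩ : 0 < Ω) {l m : Fin N}
    (hlm : l ≠ m) : onPair l m (phaseGate Real.pi) ∈ realizableOperators hbar η Ω N := by
  obtain ⟨V, V', hV, hV', hI⟩ := exists_sideband_implements hhbar.ne' hη.ne' hΩ.ne' hlm rfl
  have hT := half_period_nonneg (N := N) hη hΩ
  have h1 := Submonoid.subset_closure (s := {W | IsPulse hbar η Ω W})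
    (show IsPulse hbar η Ω (V _) from ⟨l, 0, _, _, V, hT, Or.inr (Or.inl rfl), hV, rfl⟩)
  have h2 := Submonoid.subset_closure (s := {W | IsPulse hbar η Ω W})
    (show IsPulse hbar η Ω (V' _) from
      ⟨m, 0, _, _, V', mul_nonneg zero_le_two hT, Or.inr (Or.inr rfl), hV', rfl⟩)
  exact ⟨_, mul_mem (mul_mem h1 h2) h1, hI⟩

/-- Passing through the auxiliary level implements an arbitrary phase on the level `1`. -/
theorem phaseShift_realizable (hhbar : 0 < hbar) (hη : 0 < η) (hΩ : 0 < Ω) (l : Fin N) (γ : ℝ) :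
    onQubit l !![1, 0; 0, exp (I * γ)] ∈ realizableOperators hbar η Ω N := by
  obtain ⟨V, hV, a1, -, a3, a4⟩ := exists_sideband_evolution (η := η) (Ω := Ω) hhbar.ne'
    (u := some 1) (by simp) l 0
  obtain ⟨V₁, hV₁, b1, -, b3, -⟩ := exists_sideband_evolution (η := η) (Ω := Ω) hhbar.ne'
    (u := none) (by simp) l 0
  obtain ⟨V₂, hV₂, c1, -, -, c4⟩ := exists_sideband_evolution (η := η) (Ω := Ω) hhbar.ne'
    (u := none) (by simp) l γ
  have hT := half_period_nonneg (N := N) hη hΩ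
  have hg := sideband_half_period hη.ne' hΩ.ne' l.pos
  set T := Real.pi / (η * Ω) * Real.sqrt N
  have h1 := Submonoid.subset_closure (s := {W | IsPulse hbar η Ω W})
    (show IsPulse hbar η Ω (V T) from ⟨l, 0, _, _, V, hT, Or.inr (Or.inl rfl), hV, rfl⟩)
  have h2 := Submonoid.subset_closure (s := {W | IsPulse hbar η Ω W})
    (show IsPulse hbar η Ω (V₁ T) from ⟨l, 0, _, _, V₁, hT, Or.inr (Or.inr rfl), hV₁, rfl⟩)
  have h3 := Submonoid.subset_closure (s := {W | IsPulse hbar η Ω W})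
    (show IsPulse hbar η Ω (V₂ T) from ⟨l, γ, _, _, V₂, hT, Or.inr (Or.inr rfl), hV₂, rfl⟩)
  -- Level 1 travels to the phonon, to the auxiliary level, back to the phonon with laser phase `γ`,
  -- and back to level 1: the factor is `(-i)⁴ e^{iγ}`. Level 0 without phonons stays put.
  refine ⟨V T * (V₂ T * (V₁ T * V T)), mul_mem h1 (mul_mem h3 (mul_mem h2 h1)), fun x => ?_⟩
  rw [sum_onQubit_smul, Fin.sum_univ_two]
  simp only [LinearIsometryEquiv.coe_mul, Function.comp_apply]
  rw [registerKet_eq]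
  set X : Fin N → IonLevel := fun i => some (x i) with hX
  have hxl : x l = 0 ∨ x l = 1 := by omega
  rcases hxl with hxl | hxl
  · have hXl : X l = some 0 := by simp [hX, hxl]
    rw [a1 _ _ hXl, b1 _ _ hXl, c1 _ _ hXl, a1 _ _ hXl, update_eq_of_apply_eq hxl]
    simp [hxl, registerKet_eq, hX]
  · have hXl : X l = some 1 := by simp [hX, hxl]
    have e1 : V T (ket (X, 0)) = (-I) • ket (Function.update X l (some 0), 1) := by
      rw [a4 _ _ hXl, hg]; simp
    have e2 : V₁ T (ket (Function.update X l (some 0), 1)) =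
        (-I) • ket (Function.update X l none, 0) := by
      rw [b3 _ _ (by simp), hg, Function.update_idem]; simp
    have e3 : V₂ T (ket (Function.update X l none, 0)) =
        (-I * exp (I * γ)) • ket (Function.update X l (some 0), 1) := by
      rw [c4 _ _ (by simp), hg, Function.update_idem]; simp
    have e4 : V T (ket (Function.update X l (some 0), 1)) = (-I) • ket (X, 0) := by
      rw [a3 _ _ (by simp), hg, Function.update_idem, update_eq_of_apply_eq hXl]; simp
    simp only [e1, map_smul, e2, e3, e4, update_eq_of_apply_eq hxl, smul_smul, hxl,
      Matrix.of_apply, Matrix.cons_val', Matrix.cons_val_zero, Matrix.cons_val_one, zero_smul,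
      zero_add]
    rw [← registerKet_eq]
    congr 1
    linear_combination (exp (I * γ)) * (I ^ 2 - 1) * I_sq

/-- Global phases are realizable. -/
theorem smul_one_realizable (hhbar : 0 < hbar) (hη : 0 < η) (hΩ : 0 < Ω) (l : Fin N) {c : ℂ}
    (hc : ‖c‖ = 1) : onQubit l (c • (1 : OneBit)) ∈ realizableOperators hbar η Ω N := by
  obtain ⟨γ, rfl⟩ : ∃ γ : ℝ, exp (I * γ) = c := by
    refine ⟨c.arg, ?_⟩
    have h := norm_mul_exp_arg_mul_I c
    rw [hc, ofReal_one, one_mul] at h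
    rw [mul_comm, h]
  -- Conjugation by the half-pi rotation exchanges the diagonal entries, so the product is `diag (1,
  -- e^{iγ}) diag (e^{iγ}, 1)`.
  have h : exp (I * γ) • (1 : OneBit) = !![1, 0; 0, exp (I * γ)] *
      (rotationGate (Real.pi / 2) 0 * !![1, 0; 0, exp (I * γ)] *
        rotationGate (-(Real.pi / 2)) 0) := by
    ext i j
    fin_cases i <;> fin_cases j <;>
      simp [rotationGate, Matrix.mul_apply, Fin.sum_univ_two, mul_assoc]
    linear_combination exp (I * γ) * I_sq
  rw [h, onQubit_mul, onQubit_mul, onQubit_mul]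
  have hD := phaseShift_realizable (N := N) hhbar hη hΩ l γ
  exact mul_mem hD (mul_mem (mul_mem (rotationGate_realizable hhbar hΩ l _ _) hD)
    (rotationGate_realizable hhbar hΩ l _ _))

theorem phaseGate_pi_mem_unitaryGroup :
    phaseGate Real.pi ∈ Matrix.unitaryGroup (Fin 2 × Fin 2) ℂ := by
  have h : exp (I * Real.pi) = -1 := by rw [mul_comm, exp_pi_mul_I]
  rw [Matrix.mem_unitaryGroup_iff, Matrix.star_eq_conjTranspose, phaseGate, h,
    Matrix.diagonal_conjTranspose, Matrix.diagonal_mul_diagonal, ← Matrix.diagonal_one]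
  congr 1
  funext p
  by_cases hp : p = (1, 1) <;> simp [hp]

/-- The gates available in the ion trap are universal. -/
theorem isUniversal_ion (hhbar : 0 < hbar) (hη : 0 < η) (hΩ : 0 < Ω) :
    IsUniversal (ionOneBitGates hbar η Ω) (ionTwoBitGates hbar η Ω) := by
  intro n hn U hU
  obtain ⟨c, hc, hcU⟩ := exists_smul_mem_specialUnitaryGroup hU
  have hSU : c • U ∈ compositions (ionOneBitGates hbar η Ω) (ionTwoBitGates hbar η Ω) n := by
    refine specialUnitaryGroup_le_of_gates_mem (fun θ φ l => onQubit_mem_compositions ?_ l)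
      (fun _ _ hlm => onPair_mem_compositions ?_ hlm) hcU
    · exact ⟨(Matrix.mem_specialUnitaryGroup_iff.1
        (rotationGate_mem_specialUnitaryGroup θ φ)).1,
        fun N _ l => rotationGate_realizable hhbar hΩ l θ φ⟩
    · exact ⟨phaseGate_pi_mem_unitaryGroup,
        fun N _ l m hlm => phaseGate_realizable hhbar hη hΩ hlm⟩
  have hc0 : c ≠ 0 := by rintro rfl; simp at hc
  have hci : ‖c⁻¹‖ = 1 := by rw [norm_inv, hc, inv_one]
  have hphase : c⁻¹ • (1 : OneBit) ∈ ionOneBitGates hbar η Ω := by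
    refine ⟨?_, fun N _ l => smul_one_realizable hhbar hη hΩ l hci⟩
    rw [Matrix.mem_unitaryGroup_iff, star_smul, smul_mul_smul_comm, star_one, one_mul,
      RCLike.star_def, mul_conj, normSq_eq_norm_sq, hci]
    simp
  -- A scalar gate on any one slot is a global phase; slot 0 is an arbitrary choice.
  have hU' : U = onQubit ⟨0, by omega⟩ (c⁻¹ • (1 : OneBit)) * (c • U) := by
    rw [onQubit_smul_one, smul_mul_smul_comm, one_mul, inv_mul_cancel₀ hc0, one_smul]
  rw [hU']
  exact mul_mem (onQubit_mem_compositions hphase _) hSU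

theorem compositions_ion_le {n : ℕ} (hn : 2 ≤ n) :
    compositions (ionOneBitGates hbar η Ω) (ionTwoBitGates hbar η Ω) n ≤
      realizableOperators hbar η Ω n := by
  rw [compositions, Submonoid.closure_le]
  rintro _ (⟨A, hA, l, rfl⟩ | ⟨B, hB, l, m, hlm, rfl⟩)
  · exact hA.2 n hn l
  · exact hB.2 n hn l m hlm

end Implementation

end IonTrap

theorem theorem4p4 (hbar η Ω : ℝ) (hhbar : 0 < hbar) (hη : 0 < η) (hΩ : 0 < Ω) :
    -- a resonant pulse of duration `2θ/Ω` on the ion `l` realizes the rotation gate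
    (∀ N : ℕ, 2 ≤ N → ∀ l : Fin N,
      ∀ θ ∈ Set.Icc (0 : ℝ) (2 * Real.pi), ∀ φ ∈ Set.Icc (0 : ℝ) (2 * Real.pi),
      ∃ V : ℝ → (TrapSpace N ≃ₗᵢ[ℂ] TrapSpace N),
        IsTimeEvolution hbar (carrierHamiltonian hbar Ω l (Real.pi - φ)) V ∧
        Implements (V (2 * θ / Ω)) (onQubit l (rotationGate θ φ))) ∧
    -- the three sideband pulses realize the phase gate on the ions `l` and `m`
    (∀ N : ℕ, 2 ≤ N → ∀ l m : Fin N, l ≠ m → ∀ T : ℝ,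
      T = Real.pi / (η * Ω) * Real.sqrt (N : ℝ) →
      ∃ V V' : ℝ → (TrapSpace N ≃ₗᵢ[ℂ] TrapSpace N),
        IsTimeEvolution hbar (qubitSideband hbar η Ω l 0) V ∧
        IsTimeEvolution hbar (auxSideband hbar η Ω m 0) V' ∧
        Implements (V T * V' (2 * T) * V T) (onPair l m (phaseGate Real.pi))) ∧
    -- CNOT from these gates
    (∀ n : ℕ, 2 ≤ n → ∀ l m : Fin n, l ≠ m →
      onPair l m cnot =
        onQubit m (rotationGate (Real.pi / 4) (Real.pi / 2)) * onPair l m (phaseGate Real.pi) *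
          onQubit m (rotationGate (Real.pi / 4) (-(Real.pi / 2)))) ∧
    -- universality of the two collections of gates, up to global phases
    IsUniversalUpToPhase rotations {phaseGate Real.pi} ∧
    IsUniversalUpToPhase rotations {cnot} ∧
    -- exact universality of the ion-trap quantum computer
    IsUniversal (ionOneBitGates hbar η Ω) (ionTwoBitGates hbar η Ω) ∧
    (∀ n : ℕ, 2 ≤ n → ∀ U ∈ Matrix.unitaryGroup (Bits n) ℂ, IonRealizable hbar η Ω U) := by
  refine ⟨fun N _ l θ _ φ _ => exists_carrier_implements hhbar.ne' hΩ.ne' l θ φ,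
    fun N _ l m hlm T hT => exists_sideband_implements hhbar.ne' hη.ne' hΩ.ne' hlm hT,
    fun n _ l m hlm => onPair_cnot hlm, isUniversalUpToPhase_phaseGate, isUniversalUpToPhase_cnot,
    isUniversal_ion hhbar hη hΩ, fun n hn U hU => ?_⟩
  exact compositions_ion_le hn (isUniversal_ion hhbar hη hΩ n hn U hU)
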